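/- Let $\alpha_0,\dots,\alpha_4\in\mathbb C$, with indices taken in $\mathbb Z/5\mathbb Z$. A rational solution of the $A_4^{(1)}$ Painlevé system with parameters $(\alpha_i)$ is a tuple $(f_0,\dots,f_4)$ of rational functions $f_i\in\mathbb C(t)$ such that $$f_i'=f_i\,(f_{i+1}-f_{i+2}+f_{i+3}-f_{i+4})+\alpha_i\quad(i\in\mathbb Z/5\mathbb Z),\qquad f_0+f_1+f_2+f_3+f_4=t,$$ where ${}'=d/dt$. The Bäcklund transformations are the elements of the group generated by the following maps $s_0,\dots,s_4,\pi$ on pairs $\big((\alpha_j),(f_j)\big)$. If $f_i\not\equiv0$, then $s_i$ sends $f_{i+1}\mapsto f_{i+1}+\alpha_i/f_i$, $f_{i-1}\mapsto f_{i-1}-\alpha_i/f_i$, $\alpha_i\mapsto-\alpha_i$, $\alpha_{i\pm1}\mapsto\alpha_{i\pm1}+\alpha_i$ and fixes all other entries; if $f_i\equiv0$, then $s_i$ is the identity. The map $\pi$ sends $f_j\mapsto f_{j+1}$, $\alpha_j\mapsto\alpha_{j+1}$ for all $j$. **Theorem.** The system with parameters $(\alpha_i)$ has a rational solution if and only if $\alpha_0+\alpha_1+\alpha_2+\alpha_3+\alpha_4=1$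 and one of the following three conditions holds: 1. $\alpha_0,\dots,\alpha_4\in\mathbb Z$; 2. for some $i\in\mathbb Z/5\mathbb Z$, $(\alpha_i,\alpha_{i+1},\alpha_{i+2},\alpha_{i+3},\alpha_{i+4})$ is congruent modulo $\mathbb Z$ (componentwise) to $\pm\frac13(1,1,1,0,0)$ or to $\pm\frac13(1,-1,-1,1,0)$; 3. for some $i\in\mathbb Z/5\mathbb Z$ and some $j\in\{1,2,3,4\}$, $(\alpha_i,\alpha_{i+1},\alpha_{i+2},\alpha_{i+3},\alpha_{i+4})$ is congruent modulo $\mathbb Z$ to $\frac j5(1,1,1,1,1)$ or to $\frac j5(1,2,1,3,3)$. The rational solution is unique if it exists. Furthermore, if $(f_i)$ is a rational solution for the parameters $(\alpha_i)$, then in case 1, 2, 3 respectively some Bäcklund transformation maps $\big((\alpha_i),(f_i)\big)$ to * $(f_0,\dots,f_4)=(t,0,0,0,0)$ with $(\alpha_0,\dots,\alpha_4)=(1,0,0,0,0)$; * $(f_0,\dots,f_4)=(\frac t3,\frac t3,\frac t3,0,0)$ with $(\alpha_0,\dots,\alpha_4)=(\frac13,\frac13,\frac13,0,0)$; * $(f_0,\dots,f_4)=(\frac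 t5,\frac t5,\frac t5,\frac t5,\frac t5)$ with $(\alpha_0,\dots,\alpha_4)=(\frac15,\frac15,\frac15,\frac15,\frac15)$. -/

import Mathlib

noncomputable section

namespace A4Painleve

/-- The derivative `d/dt` of a rational function `p / q` over `ℂ`, by the quotient rule
`(p' q - p q') / q ^ 2`, where `p / q` is the reduced form. The variable `t` is `RatFunc.X`. -/
def ddt (f : RatFunc ℂ) : RatFunc ℂ :=
  (algebraMap (Polynomial ℂ) (RatFunc ℂ)
      (Polynomial.derivative f.num * f.denom - f.num * Polynomial.derivative f.denom)) /
    (algebraMap (Polynomial ℂ) (RatFunc ℂ) f.denom) ^ 2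

/-- `f = (f₀, …, f₄)` is a rational solution of the `A₄⁽¹⁾` Painlevé system with parameters
`α = (α₀, …, α₄)`. Indices are in `Fin 5`, whose addition is modulo `5`. -/
def IsRationalSolution (α : Fin 5 → ℂ) (f : Fin 5 → RatFunc ℂ) : Prop :=
  (∀ i : Fin 5,
    ddt (f i) = f i * (f (i + 1) - f (i + 2) + f (i + 3) - f (i + 4)) + RatFunc.C (α i)) ∧
  ∑ i : Fin 5, f i = RatFunc.X

/-- A tuple of parameters together with a tuple of rational functions. -/
@[ext]
structure State where
  /-- the parameters -/
  α : Fin 5 → ℂ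
  /-- the rational functions -/
  f : Fin 5 → RatFunc ℂ

open scoped Classical in
/-- The transformation `s i`: if `f i ≠ 0`, then
`f (i + 1) ↦ f (i + 1) + α i / f i`, `f (i - 1) ↦ f (i - 1) - α i / f i`,
`α i ↦ - α i`, `α (i ± 1) ↦ α (i ± 1) + α i`, and the other entries are fixed;
if `f i = 0`, it is the identity. -/
def sFun (i : Fin 5) (x : State) : State :=
  if x.f i = 0 then x
  else
    { α := fun j =>
        if j = i then - x.α i
        else if j = i + 1 ∨ j = i - 1 then x.α j + x.α i
        else x.α j
      f := fun j =>
        if j = i + 1 then x.f j + RatFunc.C (x.α i) / x.f i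
        else if j = i - 1 then x.f j - RatFunc.C (x.α i) / x.f i
        else x.f j }

theorem sFun_involutive (i : Fin 5) : Function.Involutive (sFun i) := by
  intro x
  have h1 : i ≠ i + 1 := by revert i; decide
  have h2 : i ≠ i - 1 := by revert i; decide
  have h3 : i - 1 ≠ i + 1 := by revert i; decide
  by_cases h : x.f i = 0
  · simp [sFun, h]
  · ext j
    · by_cases hj : j = i
      · subst hj; simp [sFun, h, h1, h2]
      · by_cases hk : j = i + 1 ∨ j = i - 1
        · simp [sFun, h, h1, h2, hj, hk]
        · simp [sFun, h, h1, h2, hj, hk]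
    · by_cases hj : j = i + 1
      · subst hj
        simp [sFun, h, h1, h2]
        ring
      · by_cases hk : j = i - 1
        · subst hk
          simp [sFun, h, h1, h2, h3]
          ring
        · simp [sFun, h, h1, h2, hj, hk]

/-- `s i` as a permutation of the set of states. -/
def s (i : Fin 5) : Equiv.Perm State := (sFun_involutive i).toPerm

/-- The rotation `π`: `f i ↦ f (i + 1)`, `α i ↦ α (i + 1)`. -/
def rot : Equiv.Perm State where
  toFun x := { α := fun i => x.α (i + 1), f := fun i => x.f (i + 1) }
  invFun x := { α := fun i => x.α (i - 1), f := fun i => x.f (i - 1) }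
  left_inv x := by ext <;> simp
  right_inv x := by ext <;> simp

/-- The group of Bäcklund transformations, generated by `s 0, …, s 4` and `π`. -/
def backlundGroup : Subgroup (Equiv.Perm State) :=
  Subgroup.closure (Set.range s ∪ {rot})

/-- All parameters are integers. -/
def CondOne (α : Fin 5 → ℂ) : Prop :=
  ∀ i, ∃ n : ℤ, α i = n

/-- `(α i, α (i + 1), …, α (i + 4)) ≡ v` modulo `ℤ`, componentwise. -/
def ShiftCongr (α : Fin 5 → ℂ) (i : Fin 5) (v : Fin 5 → ℂ) : Prop :=
  ∀ k : Fin 5, ∃ n : ℤ, α (i + k) = v k + n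

/-- Some cyclic shift of the parameters is congruent modulo `ℤ` to
`± (1, 1, 1, 0, 0) / 3` or `± (1, -1, -1, 1, 0) / 3`. -/
def CondTwo (α : Fin 5 → ℂ) : Prop :=
  ∃ i : Fin 5,
    ShiftCongr α i ((1 / 3 : ℂ) • ![1, 1, 1, 0, 0]) ∨
    ShiftCongr α i (-(1 / 3 : ℂ) • ![1, 1, 1, 0, 0]) ∨
    ShiftCongr α i ((1 / 3 : ℂ) • ![1, -1, -1, 1, 0]) ∨
    ShiftCongr α i (-(1 / 3 : ℂ) • ![1, -1, -1, 1, 0])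

/-- Some cyclic shift of the parameters is congruent modulo `ℤ` to
`j (1, 1, 1, 1, 1) / 5` or `j (1, 2, 1, 3, 3) / 5` with `j ∈ {1, 2, 3, 4}`. -/
def CondThree (α : Fin 5 → ℂ) : Prop :=
  ∃ i : Fin 5, ∃ j : ℕ, 1 ≤ j ∧ j ≤ 4 ∧
    (ShiftCongr α i ((j / 5 : ℂ) • ![1, 1, 1, 1, 1]) ∨
     ShiftCongr α i ((j / 5 : ℂ) • ![1, 2, 1, 3, 3]))

/-- `(f₀, …, f₄) = (t, 0, 0, 0, 0)` with `(α₀, …, α₄) = (1, 0, 0, 0, 0)`. -/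
def seedOne : State where
  α := ![1, 0, 0, 0, 0]
  f := ![RatFunc.X, 0, 0, 0, 0]

/-- `(f₀, …, f₄) = (t/3, t/3, t/3, 0, 0)` with `(α₀, …, α₄) = (1/3, 1/3, 1/3, 0, 0)`. -/
def seedTwo : State where
  α := ![1 / 3, 1 / 3, 1 / 3, 0, 0]
  f := ![RatFunc.X / 3, RatFunc.X / 3, RatFunc.X / 3, 0, 0]

/-- `fᵢ = t/5` and `αᵢ = 1/5` for all `i`. -/
def seedThree : State where
  α := ![1 / 5, 1 / 5, 1 / 5, 1 / 5, 1 / 5]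
  f := ![RatFunc.X / 5, RatFunc.X / 5, RatFunc.X / 5, RatFunc.X / 5, RatFunc.X / 5]

end A4Painleve

end

noncomputable section

namespace A4Painleve

open Polynomial

-- The derivation `d/dt` on rational functions.

local notation "ι" => algebraMap (Polynomial ℂ) (RatFunc ℂ)

/-! The heart of the proof is a residue count. At a finite point a solution has at most simple
poles, and its residue vector is one of finitely many, all of the form `c i = n (i - 1) - n (i + 1)`
with natural numbers `n j`, which play the role of zero orders of five tau functions
(`residue_cases`). The cubic part of the Hamiltonian then has at most a simple pole, with residue `∑
α j * n j` (`IsRationalSolution.residue`).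

At infinity `f i = c i * t + e i / t + ⋯`, where `c` is, up to rotation, one of four explicit
vectors, and the differential equations express `α` through `c` and `e`. Equating the coefficient of
`1/t` with the sum of the residues, once for each `f i` and once for the cubic, gives `e i = N (i -
1) - N (i + 1)` and `∑ α j * N j = ∑ c j * dcubic e j`, where `N` is the sum of all the vectors `n`
(`IsRationalSolution.asymptotics`). If every `α i` is real and nonnegative (the fundamental alcove),
these relations form a Diophantine problem that forces `N = 0` (`no_poles`). Hence `f i = α i * t`,
and `α` is a rotated seed (`IsRationalSolution.of_nonneg`).

The general case reduces to the alcove. The formula for `α` shows that `15 α` is integral, the `s i`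
act on the parameters of solutions as reflections of the affine Weyl group, and reflecting in
negative coordinates terminates in the alcove (`alcove_induction`). As the `s i` are involutions
preserving solutions, uniqueness and reducibility to a seed follow from the alcove case.

The three congruence conditions are stable under reflections and rotations (`ModCongr.backlund`), so
they hold for a solution exactly when they hold for the seed it is carried to. This gives necessity
and identifies the seed. Conversely, parameters of sum 1 satisfying a condition can be reflected to
the alcove, where the condition leaves only rotations of one seed. Carrying that seed's linear
solution back proves existence. -/

theorem ι_ne_zero {b : ℂ[X]} (hb : b ≠ 0) : ι b ≠ 0 := by
  simpa using hb

theorem ι_X : ι X = RatFunc.X := RatFunc.algebraMap_X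

theorem ι_C (c : ℂ) : ι (C c) = RatFunc.C c := RatFunc.algebraMap_C c

/-- The quotient rule for an arbitrary representation of a rational function as a fraction. -/
theorem ddt_mul_sq {f : RatFunc ℂ} {a b : ℂ[X]} (h : f * ι b = ι a) :
    ddt f * ι b ^ 2 = ι (derivative a) * ι b - ι a * ι (derivative b) := by
  set n := f.num with hn
  set d := f.denom with hd
  have hd0 : ι d ≠ 0 := ι_ne_zero f.denom_ne_zero
  have hf : f * ι d = ι n := by
    rw [← eq_div_iff hd0, RatFunc.num_div_denom]
  have key : n * b = a * d := by
    apply RatFunc.algebraMap_injective ℂ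
    rw [map_mul, map_mul, ← hf, ← h]; ring
  have key' := congrArg (fun p => ι (derivative p)) key
  simp only [derivative_mul, map_add, map_mul] at key'
  rw [← h] at key' ⊢
  rw [← hf] at key'
  unfold ddt
  rw [← hn, ← hd]
  simp only [map_sub, map_mul]
  rw [← hf]
  field_simp
  linear_combination ι b * key'

theorem ddt_eq_div {f : RatFunc ℂ} {a b : ℂ[X]} (hb : b ≠ 0) (h : f * ι b = ι a) :
    ddt f = (ι (derivative a) * ι b - ι a * ι (derivative b)) / ι b ^ 2 := by
  rw [eq_div_iff (pow_ne_zero 2 (ι_ne_zero hb)), ddt_mul_sq h]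

theorem exists_frac (f : RatFunc ℂ) : ∃ a b : ℂ[X], b ≠ 0 ∧ f * ι b = ι a := by
  refine ⟨f.num, f.denom, f.denom_ne_zero, ?_⟩
  have hd0 : ι f.denom ≠ 0 := ι_ne_zero f.denom_ne_zero
  rw [← eq_div_iff hd0, RatFunc.num_div_denom]

theorem ddt_ι (p : ℂ[X]) : ddt (ι p) = ι (derivative p) := by
  rw [ddt_eq_div (a := p) (b := 1) one_ne_zero (by simp)]
  simp

@[simp] theorem ddt_C (c : ℂ) : ddt (RatFunc.C c) = 0 := by
  rw [← ι_C, ddt_ι]; simp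

@[simp] theorem ddt_X : ddt RatFunc.X = 1 := by
  rw [← ι_X, ddt_ι]; simp

@[simp] theorem ddt_zero : ddt 0 = 0 := by
  simpa using ddt_C 0

theorem ddt_add (f g : RatFunc ℂ) : ddt (f + g) = ddt f + ddt g := by
  obtain ⟨a, b, hb, h⟩ := exists_frac f
  obtain ⟨a', b', hb', h'⟩ := exists_frac g
  have h0 := ι_ne_zero hb
  have h0' := ι_ne_zero hb'
  have e : (f + g) * ι (b * b') = ι (a * b' + a' * b) := by
    simp only [map_add, map_mul]
    linear_combination ι b' * h + ι b * h'
  rw [ddt_eq_div (mul_ne_zero hb hb') e, ddt_eq_div hb h, ddt_eq_div hb' h']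
  simp only [derivative_mul, map_add, map_mul]
  field_simp
  ring

theorem ddt_mul (f g : RatFunc ℂ) : ddt (f * g) = ddt f * g + f * ddt g := by
  obtain ⟨a, b, hb, h⟩ := exists_frac f
  obtain ⟨a', b', hb', h'⟩ := exists_frac g
  have h0 := ι_ne_zero hb
  have h0' := ι_ne_zero hb'
  have e : (f * g) * ι (b * b') = ι (a * a') := by
    simp only [map_mul]
    linear_combination g * ι b' * h + ι a * h'
  rw [ddt_eq_div (mul_ne_zero hb hb') e, ddt_eq_div hb h, ddt_eq_div hb' h']
  rw [← eq_div_iff h0] at h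
  rw [← eq_div_iff h0'] at h'
  simp only [derivative_mul, map_add, map_mul, h, h']
  field_simp
  ring

/-- `d/dt` as a derivation of the field of rational functions. -/
def D : Derivation ℂ (RatFunc ℂ) (RatFunc ℂ) where
  toFun := ddt
  map_add' := ddt_add
  map_smul' c f := by
    simp [RatFunc.smul_eq_C_mul, ddt_mul]
  map_one_eq_zero' := by simpa using ddt_C 1
  leibniz' f g := by simp [ddt_mul, mul_comm, add_comm]

theorem ddt_C_mul (c : ℂ) (f : RatFunc ℂ) : ddt (RatFunc.C c * f) = RatFunc.C c * ddt f := by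
  simp [ddt_mul]

theorem ddt_sub (f g : RatFunc ℂ) : ddt (f - g) = ddt f - ddt g := map_sub D f g

theorem ddt_sum {κ : Type*} (s : Finset κ) (f : κ → RatFunc ℂ) :
    ddt (∑ i ∈ s, f i) = ∑ i ∈ s, ddt (f i) := map_sum D f s

theorem ddt_pow (f : RatFunc ℂ) (n : ℕ) : ddt (f ^ n) = n * f ^ (n - 1) * ddt f := by
  change D (f ^ n) = n * f ^ (n - 1) * D f
  rw [D.leibniz_pow f n, smul_eq_mul, nsmul_eq_mul, mul_assoc]

theorem ddt_C_div (c : ℂ) {f : RatFunc ℂ} (hf : f ≠ 0) :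
    ddt (RatFunc.C c / f) = - RatFunc.C c * ddt f / f ^ 2 := by
  have h : RatFunc.C c / f * f = RatFunc.C c := div_mul_cancel₀ _ hf
  have h2 := congrArg ddt h
  rw [ddt_mul, ddt_C] at h2
  field_simp at h2 ⊢
  linear_combination h2

/-! ### The transformations preserve rational solutions -/

/-- The action of `s i` on parameters. -/
def refl {R : Type*} [AddCommGroup R] (i : Fin 5) (a : Fin 5 → R) : Fin 5 → R := fun j =>
  if j = i then - a i else if j = i + 1 ∨ j = i - 1 then a j + a i else a j

theorem s_apply (i : Fin 5) (x : State) : s i x = sFun i x := rfl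

theorem sFun_of_ne_zero {i : Fin 5} {x : State} (h : x.f i ≠ 0) :
    (sFun i x).α = refl i x.α ∧ (sFun i x).f = fun j =>
        if j = i + 1 then x.f j + RatFunc.C (x.α i) / x.f i
        else if j = i - 1 then x.f j - RatFunc.C (x.α i) / x.f i
        else x.f j := by
  constructor
  · simp only [sFun, h, if_false]
    rfl
  · simp only [sFun, h, if_false]

theorem fin_five_cases (i : Fin 5) : i = 0 ∨ i = 1 ∨ i = 2 ∨ i = 3 ∨ i = 4 := by
  revert i; decide

/-- The quadratic terms cancel by skew-symmetry, so the sum of the five equations reads `t' = ∑ α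
i`. -/
theorem IsRationalSolution.sum_param {α : Fin 5 → ℂ} {f : Fin 5 → RatFunc ℂ}
    (h : IsRationalSolution α f) : ∑ i, α i = 1 := by
  have h1 := congrArg ddt h.2
  rw [ddt_sum, ddt_X] at h1
  simp only [h.1] at h1
  have h2 : RatFunc.C (∑ i, α i) = RatFunc.C 1 := by
    rw [map_sum, map_one, ← h1]
    simp only [Fin.sum_univ_five, Fin.isValue, Fin.reduceAdd]
    ring
  exact RatFunc.C_injective h2

theorem IsRationalSolution.sFun {α : Fin 5 → ℂ} {f : Fin 5 → RatFunc ℂ}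
    (h : IsRationalSolution α f) (i : Fin 5) :
    (sFun i ⟨α, f⟩).α = refl i α ∧ IsRationalSolution (refl i α) (sFun i ⟨α, f⟩).f := by
  by_cases hf : f i = 0
  · have hα : α i = 0 := by
      have := h.1 i
      rw [hf, ddt_zero, zero_mul, zero_add] at this
      exact RatFunc.C_injective (by simpa using this.symm)
    have hr : refl i α = α := by
      ext j; unfold refl; split_ifs with h1 h2 <;> simp [h1, hα]
    simpa [A4Painleve.sFun, hf, hr] using h
  · obtain ⟨h1, h2⟩ := sFun_of_ne_zero (x := ⟨α, f⟩) hf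
    refine ⟨h1, ?_⟩
    rw [h2]
    have hd := ddt_C_div (α i) hf
    obtain ⟨ho, hs⟩ := h
    rw [Fin.sum_univ_five] at hs
    have o0 := ho 0
    have o1 := ho 1
    have o2 := ho 2
    have o3 := ho 3
    have o4 := ho 4
    simp only [Fin.isValue, Fin.reduceAdd] at o0 o1 o2 o3 o4
    have hm : (-1 : Fin 5) = 4 := rfl
    constructor
    · intro j
      rcases fin_five_cases i with rfl | rfl | rfl | rfl | rfl <;>
      rcases fin_five_cases j with rfl | rfl | rfl | rfl | rfl <;>
        simp [refl, ddt_add, ddt_sub, hm] at hd hf ⊢ <;>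
        simp only [hd, o0, o1, o2, o3, o4] <;> field_simp <;> ring
    · rcases fin_five_cases i with rfl | rfl | rfl | rfl | rfl <;>
        simp [Fin.sum_univ_five, hm] at hf ⊢ <;> linear_combination hs

theorem IsRationalSolution.shift {α : Fin 5 → ℂ} {f : Fin 5 → RatFunc ℂ}
    (h : IsRationalSolution α f) (k : Fin 5) :
    IsRationalSolution (fun i => α (i + k)) (fun i => f (i + k)) := by
  constructor
  · intro i
    have := h.1 (i + k)
    simpa only [add_right_comm] using this
  · rw [← h.2]
    exact Equiv.sum_comp (Equiv.addRight k) f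

/-! ### Values of rational functions at finite points -/

/-- `f` is regular at `p` with value `c`. -/
def HasVal (p : ℂ) (f : RatFunc ℂ) (c : ℂ) : Prop :=
  ∃ a b : ℂ[X], b.eval p ≠ 0 ∧ f * ι b = ι a ∧ c * b.eval p = a.eval p

namespace HasVal

variable {p : ℂ} {f g : RatFunc ℂ} {c d : ℂ}

theorem of_poly (p : ℂ) (a : ℂ[X]) : HasVal p (ι a) (a.eval p) :=
  ⟨a, 1, by simp, by simp, by simp⟩

theorem const (p c : ℂ) : HasVal p (RatFunc.C c) c := by
  simpa [ι_C] using of_poly p (C c)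

theorem zero (p : ℂ) : HasVal p 0 0 := by simpa using const p 0

theorem var (p : ℂ) : HasVal p RatFunc.X p := by
  simpa [ι_X] using of_poly p X

theorem add (h : HasVal p f c) (h' : HasVal p g d) : HasVal p (f + g) (c + d) := by
  obtain ⟨a, b, hb, e, v⟩ := h
  obtain ⟨a', b', hb', e', v'⟩ := h'
  refine ⟨a * b' + a' * b, b * b', by simp [hb, hb'], ?_, ?_⟩
  · simp only [map_add, map_mul]
    linear_combination ι b' * e + ι b * e'
  · simp only [eval_add, eval_mul]
    linear_combination b'.eval p * v + b.eval p * v'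

theorem mul (h : HasVal p f c) (h' : HasVal p g d) : HasVal p (f * g) (c * d) := by
  obtain ⟨a, b, hb, e, v⟩ := h
  obtain ⟨a', b', hb', e', v'⟩ := h'
  refine ⟨a * a', b * b', by simp [hb, hb'], ?_, ?_⟩
  · simp only [map_mul]
    linear_combination g * ι b' * e + ι a * e'
  · simp only [eval_mul]
    linear_combination d * b'.eval p * v + a.eval p * v'

theorem neg (h : HasVal p f c) : HasVal p (-f) (-c) := by
  simpa using (const p (-1)).mul h

theorem sub (h : HasVal p f c) (h' : HasVal p g d) : HasVal p (f - g) (c - d) := by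
  simpa [sub_eq_add_neg] using h.add h'.neg

theorem pow (h : HasVal p f c) (n : ℕ) : HasVal p (f ^ n) (c ^ n) := by
  induction n with
  | zero => simpa using const p 1
  | succ n ih => simpa [pow_succ] using ih.mul h

theorem sum {κ : Type*} {s : Finset κ} {F : κ → RatFunc ℂ} {v : κ → ℂ}
    (h : ∀ i ∈ s, HasVal p (F i) (v i)) : HasVal p (∑ i ∈ s, F i) (∑ i ∈ s, v i) := by
  classical
  induction s using Finset.induction_on with
  | empty => simpa using zero p
  | insert i s hi ih =>
    rw [Finset.sum_insert hi, Finset.sum_insert hi]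
    exact (h i (by simp)).add (ih fun j hj => h j (by simp [hj]))

theorem unique (h : HasVal p f c) (h' : HasVal p f d) : c = d := by
  obtain ⟨a, b, hb, e, v⟩ := h
  obtain ⟨a', b', hb', e', v'⟩ := h'
  have key : a * b' = a' * b := by
    apply RatFunc.algebraMap_injective ℂ
    rw [map_mul, map_mul, ← e, ← e']; ring
  have := congrArg (eval p) key
  simp only [eval_mul, ← v, ← v'] at this
  have h2 : b.eval p * b'.eval p ≠ 0 := mul_ne_zero hb hb'
  apply mul_right_cancel₀ h2
  linear_combination this

theorem ddt (h : HasVal p f c) : ∃ d, HasVal p (ddt f) d := by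
  obtain ⟨a, b, hb, e, -⟩ := h
  refine ⟨(eval p (derivative a * b - a * derivative b)) / eval p (b ^ 2),
    derivative a * b - a * derivative b, b ^ 2, by simp [hb], ?_, ?_⟩
  · simp only [map_sub, map_mul, map_pow]
    exact ddt_mul_sq e
  · rw [div_mul_cancel₀]
    simp [hb]

end HasVal

/-- The uniformizer `t - p`. -/
def unif (p : ℂ) : RatFunc ℂ := RatFunc.X - RatFunc.C p

theorem unif_eq (p : ℂ) : unif p = ι (X - C p) := by
  rw [map_sub, ι_X, ι_C]; rfl

theorem unif_ne_zero (p : ℂ) : unif p ≠ 0 := by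
  rw [unif_eq]; exact ι_ne_zero (X_sub_C_ne_zero p)

@[simp] theorem ddt_unif (p : ℂ) : ddt (unif p) = 1 := by
  simp [unif, ddt_sub]

theorem HasVal.unif (p q : ℂ) : HasVal p (unif q) (p - q) := (HasVal.var p).sub (HasVal.const p q)

theorem HasVal.unif_self (p : ℂ) : HasVal p (A4Painleve.unif p) 0 := by
  simpa using HasVal.unif p p

theorem HasVal.inv_unif {p q : ℂ} (h : p ≠ q) : HasVal p (A4Painleve.unif q)⁻¹ (p - q)⁻¹ := by
  have h' := sub_ne_zero.2 h
  refine ⟨1, X - C q, by simpa using h', ?_, ?_⟩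
  · rw [← unif_eq, inv_mul_cancel₀ (unif_ne_zero q), map_one]
  · simp [h']

theorem HasVal.div_unif {p : ℂ} {f : RatFunc ℂ} (h : HasVal p (A4Painleve.unif p * f) 0) :
    ∃ c, HasVal p f c := by
  obtain ⟨a, b, hb, e, v⟩ := h
  rw [zero_mul] at v
  obtain ⟨a', rfl⟩ := dvd_iff_isRoot.2 v.symm
  refine ⟨a'.eval p / b.eval p, a', b, hb, ?_, div_mul_cancel₀ _ hb⟩
  apply mul_left_cancel₀ (unif_ne_zero p)
  rw [map_mul, ← unif_eq] at e
  linear_combination e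

theorem HasVal.exists_pow (p : ℂ) (f : RatFunc ℂ) :
    ∃ m : ℕ, ∃ c, HasVal p (A4Painleve.unif p ^ m * f) c := by
  obtain ⟨a, b, hb, e⟩ := exists_frac f
  obtain ⟨b', h1, h2⟩ := exists_eq_pow_rootMultiplicity_mul_and_not_dvd b hb p
  refine ⟨b.rootMultiplicity p, a.eval p / b'.eval p, a, b', ?_, ?_, ?_⟩
  · exact fun h => h2 (dvd_iff_isRoot.2 h)
  · rw [← e]
    conv_rhs => rw [h1]
    rw [map_mul, map_pow, ← unif_eq]; ring
  · exact div_mul_cancel₀ _ fun h => h2 (dvd_iff_isRoot.2 h)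

theorem HasVal.of_le {p : ℂ} {f : RatFunc ℂ} {m n : ℕ} (hmn : m ≤ n)
    (h : ∃ c, HasVal p (A4Painleve.unif p ^ m * f) c) :
    ∃ c, HasVal p (A4Painleve.unif p ^ n * f) c := by
  obtain ⟨c, hc⟩ := h
  obtain ⟨k, rfl⟩ := Nat.exists_eq_add_of_le hmn
  have := ((HasVal.unif_self p).pow k).mul hc
  rw [← mul_assoc, ← pow_add, add_comm] at this
  exact ⟨_, this⟩

/-- The pole order of a finite family of rational functions, with the leading coefficients. -/
theorem exists_pole_order {κ : Type*} [Fintype κ] (p : ℂ) (f : κ → RatFunc ℂ) :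
    ∃ m : ℕ, ∃ c : κ → ℂ, (∀ i, HasVal p (unif p ^ m * f i) (c i)) ∧ (m = 0 ∨ c ≠ 0) := by
  classical
  have hex : ∃ m : ℕ, ∀ i, ∃ c, HasVal p (unif p ^ m * f i) c := by
    choose m hm using fun i => HasVal.exists_pow p (f i)
    exact ⟨∑ i, m i, fun i =>
      HasVal.of_le (Finset.single_le_sum (f := m) (fun _ _ => Nat.zero_le _) (Finset.mem_univ i))
        (hm i)⟩
  choose c hc using Nat.find_spec hex
  refine ⟨Nat.find hex, c, hc, ?_⟩
  -- If all leading coefficients vanished, one factor of the uniformizer could be removed,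
  -- contradicting the minimality of the order.
  by_contra! hcon
  obtain ⟨h0, hc0⟩ := hcon
  obtain ⟨k, hk⟩ := Nat.exists_eq_succ_of_ne_zero h0
  refine Nat.find_min hex (m := k) (by omega) fun i => ?_
  apply HasVal.div_unif
  have := hc i
  rw [hk, hc0, Nat.succ_eq_add_one, pow_succ'] at this
  simpa [mul_assoc] using this

/-- If `f` has leading term `c * u ^ (-m)`, its derivative has leading term `-m * c * u ^ (-m - 1)`.
-/
theorem HasVal.ddt_pow_mul {p c : ℂ} {f : RatFunc ℂ} {m : ℕ}
    (h : HasVal p (A4Painleve.unif p ^ m * f) c) :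
    HasVal p (A4Painleve.unif p ^ (m + 1) * A4Painleve.ddt f) (-(m * c)) := by
  obtain ⟨d, hd⟩ := h.ddt
  have h1 := ((HasVal.unif_self p).mul hd).sub ((HasVal.const p m).mul h)
  rw [zero_mul, zero_sub] at h1
  convert h1 using 1
  rw [ddt_mul, ddt_pow, ddt_unif]
  rcases m with _ | m
  · simp
  · simp; ring

/-- A rational function whose derivative has at most a double pole has at most a simple pole. -/
theorem HasVal.of_ddt {p q : ℂ} {g : RatFunc ℂ}
    (h : HasVal p (A4Painleve.unif p ^ 2 * A4Painleve.ddt g) q) :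
    HasVal p (A4Painleve.unif p * g) (-q) := by
  obtain ⟨m, c, hc, hm⟩ := exists_pole_order p (fun _ : Unit => g)
  have hc := hc ()
  have h1 := hc.ddt_pow_mul
  match m, hm with
  | 0, _ =>
    have h2 := (HasVal.unif_self p).mul h1
    rw [zero_add, pow_one, ← mul_assoc, ← sq] at h2
    have hq := h.unique h2
    have := (HasVal.unif_self p).mul hc
    simpa [hq] using this
  | 1, _ =>
    have hq := h.unique h1
    simpa [hq] using hc
  | k + 2, hm =>
    exfalso
    -- A pole of order `k + 2` would give `g'` a pole of order `k + 3 > 2`, so the leading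
    -- coefficient has to vanish.
    have h2 := ((HasVal.unif_self p).pow (k + 1)).mul h
    rw [← mul_assoc, ← pow_add] at h2
    have h3 := h1.unique h2
    have hk : ((k + 2 : ℕ) : ℂ) ≠ 0 := Nat.cast_ne_zero.2 (by omega)
    have hc0 : c () = 0 := by
      rw [zero_pow (Nat.succ_ne_zero k), zero_mul, neg_eq_zero] at h3
      exact (mul_eq_zero.1 h3).resolve_left hk
    rcases hm with hm | hm
    · omega
    · exact hm (funext fun _ => hc0)

/-! ### The quadratic and cubic forms of the system -/

/-- The skew-symmetric linear form of the system. -/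
def skew {R : Type*} [CommRing R] (v : Fin 5 → R) (i : Fin 5) : R :=
  v (i + 1) - v (i + 2) + v (i + 3) - v (i + 4)

/-- The cubic part of the Hamiltonian. -/
def cubic {R : Type*} [CommRing R] (v : Fin 5 → R) : R :=
  ∑ i, v i * v (i + 1) * v (i + 2)

/-- The partial derivatives of the cubic part of the Hamiltonian. -/
def dcubic {R : Type*} [CommRing R] (v : Fin 5 → R) (j : Fin 5) : R :=
  v (j + 1) * v (j + 2) + v (j + 4) * v (j + 1) + v (j + 3) * v (j + 4)

theorem HasVal.skew {p : ℂ} {v : Fin 5 → RatFunc ℂ} {c : Fin 5 → ℂ}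
    (h : ∀ i, HasVal p (v i) (c i)) (i : Fin 5) :
    HasVal p (skew v i) (skew c i) :=
  (((h _).sub (h _)).add (h _)).sub (h _)

theorem HasVal.dcubic {p : ℂ} {v : Fin 5 → RatFunc ℂ} {c : Fin 5 → ℂ}
    (h : ∀ i, HasVal p (v i) (c i)) (i : Fin 5) :
    HasVal p (dcubic v i) (dcubic c i) :=
  (((h _).mul (h _)).add ((h _).mul (h _))).add ((h _).mul (h _))

theorem skew_smul {R : Type*} [CommRing R] (a : R) (v : Fin 5 → R) (i : Fin 5) :
    skew (fun i => a * v i) i = a * skew v i := by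
  simp only [skew]; ring

theorem dcubic_smul {R : Type*} [CommRing R] (a : R) (v : Fin 5 → R) (i : Fin 5) :
    dcubic (fun i => a * v i) i = a ^ 2 * dcubic v i := by
  simp only [dcubic]; ring

theorem IsRationalSolution.ode {α : Fin 5 → ℂ} {f : Fin 5 → RatFunc ℂ}
    (h : IsRationalSolution α f) (i : Fin 5) : ddt (f i) = f i * skew f i + RatFunc.C (α i) :=
  h.1 i

/-- The cubic form is a first integral of the homogeneous quadratic flow, so only the constant terms
contribute. At a simple pole of `f` this brings the pole order of the derivative down from 4 to 2,
and hence that of the cubic from 3 to 1. -/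
theorem IsRationalSolution.ddt_cubic {α : Fin 5 → ℂ} {f : Fin 5 → RatFunc ℂ}
    (h : IsRationalSolution α f) :
    ddt (cubic f) = ∑ j, RatFunc.C (α j) * dcubic f j := by
  simp only [cubic, dcubic, Fin.sum_univ_five, Fin.isValue, Fin.reduceAdd]
  simp only [ddt_add, ddt_mul, h.ode, skew, Fin.isValue, Fin.reduceAdd]
  ring

/-- Rules out finite poles of order at least 2 and growth faster than `t` at infinity: there the
quadratic terms dominate both `f'` and `α`, and `t` does not reach the leading order of the sum.
Each choice of which factors vanish gives a linear system with only the zero solution. -/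
theorem leading_eq_zero {c : Fin 5 → ℂ} (h : ∀ i, c i * skew c i = 0) (hs : ∑ i, c i = 0) :
    c = 0 := by
  have h0 := h 0
  have h1 := h 1
  have h2 := h 2
  have h3 := h 3
  have h4 := h 4
  simp only [skew, mul_eq_zero, Fin.sum_univ_five, Fin.isValue, Fin.reduceAdd] at *
  have : c 0 = 0 ∧ c 1 = 0 ∧ c 2 = 0 ∧ c 3 = 0 ∧ c 4 = 0 := by
    rcases h0 with h0 | h0 <;> rcases h1 with h1 | h1 <;> rcases h2 with h2 | h2 <;>
    rcases h3 with h3 | h3 <;> rcases h4 with h4 | h4 <;> grind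
  obtain ⟨a0, a1, a2, a3, a4⟩ := this
  ext i
  rcases fin_five_cases i with rfl | rfl | rfl | rfl | rfl <;> assumption

/-- Residue vectors at a pole come from zero orders of five tau functions. -/
theorem residue_cases {c : Fin 5 → ℂ} (h : ∀ i, c i = 0 ∨ skew c i = -1) (hs : ∑ i, c i = 0) :
    ∃ n : Fin 5 → ℕ, (∀ i, c i = n (i + 4) - n (i + 1)) ∧ ∀ j, dcubic c j = - n j := by
  suffices H : ∃ n0 n1 n2 n3 n4 : ℕ, (c 0 = n4 - n1 ∧ c 1 = n0 - n2 ∧ c 2 = n1 - n3 ∧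
      c 3 = n2 - n4 ∧ c 4 = n3 - n0) ∧
      (c 1 * c 2 + c 4 * c 1 + c 3 * c 4 = -n0 ∧ c 2 * c 3 + c 0 * c 2 + c 4 * c 0 = -n1 ∧
       c 3 * c 4 + c 1 * c 3 + c 0 * c 1 = -n2 ∧ c 4 * c 0 + c 2 * c 4 + c 1 * c 2 = -n3 ∧
       c 0 * c 1 + c 3 * c 0 + c 2 * c 3 = -n4) by
    obtain ⟨n0, n1, n2, n3, n4, ⟨e0, e1, e2, e3, e4⟩, d0, d1, d2, d3, d4⟩ := H
    refine ⟨![n0, n1, n2, n3, n4], fun i => ?_, fun j => ?_⟩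
    · rcases fin_five_cases i with rfl | rfl | rfl | rfl | rfl <;> assumption
    · rcases fin_five_cases j with rfl | rfl | rfl | rfl | rfl <;> assumption
  have h0 := h 0
  have h1 := h 1
  have h2 := h 2
  have h3 := h 3
  have h4 := h 4
  simp only [skew, Fin.sum_univ_five, Fin.isValue, Fin.reduceAdd] at h0 h1 h2 h3 h4 hs
  clear h
  generalize c 0 = x0, c 1 = x1, c 2 = x2, c 3 = x3, c 4 = x4 at *
  -- Each of the 32 choices is a linear system. The consistent ones take the alternative `skew = -1`
  -- at none, two or four indices. With four, the entry 3 sits at the remaining index.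
  rcases h0 with h0 | h0 <;>
  rcases h1 with h1 | h1 <;>
  rcases h2 with h2 | h2 <;>
  rcases h3 with h3 | h3 <;>
  rcases h4 with h4 | h4
  · exact ⟨0, 0, 0, 0, 0, by push_cast; grind, by push_cast; grind⟩
  · exfalso; grind
  · exfalso; grind
  · exact ⟨1, 0, 1, 0, 0, by push_cast; grind, by push_cast; grind⟩
  · exfalso; grind
  · exact ⟨0, 0, 0, 1, 0, by push_cast; grind, by push_cast; grind⟩
  · exact ⟨0, 1, 0, 0, 1, by push_cast; grind, by push_cast; grind⟩
  · exfalso; grind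
  · exfalso; grind
  · exact ⟨1, 0, 0, 0, 0, by push_cast; grind, by push_cast; grind⟩
  · exact ⟨0, 0, 1, 0, 0, by push_cast; grind, by push_cast; grind⟩
  · exfalso; grind
  · exact ⟨1, 0, 0, 1, 0, by push_cast; grind, by push_cast; grind⟩
  · exfalso; grind
  · exfalso; grind
  · exact ⟨3, 1, 0, 0, 1, by push_cast; grind, by push_cast; grind⟩
  · exfalso; grind
  · exact ⟨0, 1, 0, 1, 0, by push_cast; grind, by push_cast; grind⟩
  · exact ⟨0, 0, 0, 0, 1, by push_cast; grind, by push_cast; grind⟩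
  · exfalso; grind
  · exact ⟨0, 1, 0, 0, 0, by push_cast; grind, by push_cast; grind⟩
  · exfalso; grind
  · exfalso; grind
  · exact ⟨1, 3, 1, 0, 0, by push_cast; grind, by push_cast; grind⟩
  · exact ⟨0, 0, 1, 0, 1, by push_cast; grind, by push_cast; grind⟩
  · exfalso; grind
  · exfalso; grind
  · exact ⟨0, 1, 3, 1, 0, by push_cast; grind, by push_cast; grind⟩
  · exfalso; grind
  · exact ⟨0, 0, 1, 3, 1, by push_cast; grind, by push_cast; grind⟩
  · exact ⟨1, 0, 0, 1, 3, by push_cast; grind, by push_cast; grind⟩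
  · exfalso; grind

/-- The last clause makes regular points contribute nothing: without it the residues would determine
`n` only up to adding a constant vector. -/
theorem IsRationalSolution.residue {α : Fin 5 → ℂ} {f : Fin 5 → RatFunc ℂ}
    (h : IsRationalSolution α f) (p : ℂ) :
    ∃ n : Fin 5 → ℕ, (∀ i, HasVal p (unif p * f i) (n (i + 4) - n (i + 1))) ∧
      HasVal p (unif p * cubic f) (∑ j, α j * n j) ∧ ((∀ i, n (i + 4) = n (i + 1)) → n = 0) := by
  obtain ⟨m, c, hc, hm⟩ := exists_pole_order p f
  obtain ⟨c, hc, hr, hs⟩ : ∃ c : Fin 5 → ℂ, (∀ i, HasVal p (unif p * f i) (c i)) ∧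
      (∀ i, c i = 0 ∨ skew c i = -1) ∧ ∑ i, c i = 0 := by
    have hu := HasVal.unif_self p
    have hsum : ∑ i, unif p ^ m * f i = unif p ^ m * RatFunc.X := by
      rw [← Finset.mul_sum, h.2]
    have hs := HasVal.sum (s := Finset.univ) fun i _ => hc i
    rw [hsum] at hs
    have hq := fun i => (hc i).mul (HasVal.skew hc i)
    simp only [skew_smul] at hq
    match m, hm with
    | 0, _ => exact ⟨0, fun i => by simpa using hu.mul (hc i), by simp, by simp⟩
    | 1, _ =>
      refine ⟨c, by simpa using hc, fun i => ?_, ?_⟩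
      · have h1 := (hc i).ddt_pow_mul
        have h2 := (hq i).add ((hu.pow 2).mul (HasVal.const p (α i)))
        have h3 := h1.unique (d := c i * skew c i + 0 ^ 2 * α i) (by
          convert h2 using 1
          rw [h.ode]; ring)
        have h4 : c i * (skew c i + 1) = 0 := by
          simp at h3
          linear_combination -h3
        rcases mul_eq_zero.1 h4 with h5 | h5
        · exact Or.inl h5
        · exact Or.inr (by linear_combination h5)
      · have := (hu.pow 1).mul (HasVal.var p)
        simpa using hs.unique this
    | k + 2, hm =>
      exfalso
      have hc0 : c = 0 := by
        apply leading_eq_zero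
        · intro i
          have h1 := (hu.pow (k + 1)).mul (hc i).ddt_pow_mul
          have h2 := (hq i).add ((hu.pow (2 * (k + 2))).mul (HasVal.const p (α i)))
          have h3 := h1.unique (d := c i * skew c i + 0 ^ (2 * (k + 2)) * α i) (by
            convert h2 using 1
            rw [h.ode]; ring)
          simpa using h3.symm
        · have := (hu.pow (k + 2)).mul (HasVal.var p)
          simpa using hs.unique this
      rcases hm with hm | hm
      · omega
      · exact hm hc0
  obtain ⟨n, hn, hd⟩ := residue_cases hr hs
  refine ⟨n, fun i => hn i ▸ hc i, ?_, fun h0 => ?_⟩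
  swap
  · have hc0 : c = 0 := funext fun i => by simp [hn, h0]
    ext j
    have := hd j
    rw [hc0] at this
    simpa [dcubic, eq_comm] using this
  have h1 : HasVal p (unif p ^ 2 * ddt (cubic f)) (∑ j, α j * dcubic c j) := by
    rw [h.ddt_cubic, Finset.mul_sum]
    refine HasVal.sum fun j _ => ?_
    have := (HasVal.const p (α j)).mul (HasVal.dcubic hc j)
    rw [dcubic_smul] at this
    convert this using 1
    ring
  have h2 := h1.of_ddt
  convert h2 using 1
  simp [hd]

/-! ### Values of rational functions at infinity -/

/-- `f` is regular at infinity with value `c`. -/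
def HasValInf (f : RatFunc ℂ) (c : ℂ) : Prop :=
  ∃ (n : ℕ) (a b : ℂ[X]), b.natDegree ≤ n ∧ a.natDegree ≤ n ∧ b.coeff n ≠ 0 ∧ f * ι b = ι a ∧
    c * b.coeff n = a.coeff n

theorem X_ne_zero' : (RatFunc.X : RatFunc ℂ) ≠ 0 := RatFunc.X_ne_zero

theorem ne_zero_of_coeff_ne_zero {b : ℂ[X]} {n : ℕ} (h : b.coeff n ≠ 0) : b ≠ 0 := by
  rintro rfl; simp at h

theorem natDegree_mul_le_two_mul {a b : ℂ[X]} {m n : ℕ} (ha : a.natDegree ≤ m)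
    (hb : b.natDegree ≤ n) : (a * b).natDegree ≤ m + n :=
  natDegree_mul_le.trans (add_le_add ha hb)

namespace HasValInf

variable {f g : RatFunc ℂ} {c d : ℂ}

theorem const (c : ℂ) : HasValInf (RatFunc.C c) c :=
  ⟨0, C c, 1, by simp, by simp, by simp, by simp, by simp⟩

theorem zero : HasValInf 0 0 := by simpa using const 0

theorem add (h : HasValInf f c) (h' : HasValInf g d) : HasValInf (f + g) (c + d) := by
  obtain ⟨n, a, b, hb, ha, h0, e, v⟩ := h
  obtain ⟨n', a', b', hb', ha', h0', e', v'⟩ := h'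
  refine ⟨n + n', a * b' + a' * b, b * b', natDegree_mul_le_two_mul hb hb', ?_, ?_, ?_, ?_⟩
  · refine natDegree_add_le_of_degree_le (natDegree_mul_le_two_mul ha hb') ?_
    rw [add_comm]; exact natDegree_mul_le_two_mul ha' hb
  · rw [coeff_mul_add_eq_of_natDegree_le hb hb']; exact mul_ne_zero h0 h0'
  · simp only [map_add, map_mul]
    linear_combination ι b' * e + ι b * e'
  · rw [coeff_add, coeff_mul_add_eq_of_natDegree_le hb hb',
      coeff_mul_add_eq_of_natDegree_le ha hb', add_comm n,
      coeff_mul_add_eq_of_natDegree_le ha' hb]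
    linear_combination b'.coeff n' * v + b.coeff n * v'

theorem mul (h : HasValInf f c) (h' : HasValInf g d) : HasValInf (f * g) (c * d) := by
  obtain ⟨n, a, b, hb, ha, h0, e, v⟩ := h
  obtain ⟨n', a', b', hb', ha', h0', e', v'⟩ := h'
  refine ⟨n + n', a * a', b * b', natDegree_mul_le_two_mul hb hb', natDegree_mul_le_two_mul ha ha',
    ?_, ?_, ?_⟩
  · rw [coeff_mul_add_eq_of_natDegree_le hb hb']; exact mul_ne_zero h0 h0'
  · simp only [map_mul]
    linear_combination g * ι b' * e + ι a * e'
  · rw [coeff_mul_add_eq_of_natDegree_le hb hb', coeff_mul_add_eq_of_natDegree_le ha ha']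
    linear_combination d * b'.coeff n' * v + a.coeff n * v'

theorem neg (h : HasValInf f c) : HasValInf (-f) (-c) := by
  simpa using (const (-1)).mul h

theorem sub (h : HasValInf f c) (h' : HasValInf g d) : HasValInf (f - g) (c - d) := by
  simpa [sub_eq_add_neg] using h.add h'.neg

theorem pow (h : HasValInf f c) (n : ℕ) : HasValInf (f ^ n) (c ^ n) := by
  induction n with
  | zero => simpa using const 1
  | succ n ih => simpa [pow_succ] using ih.mul h

theorem sum {κ : Type*} {s : Finset κ} {F : κ → RatFunc ℂ} {v : κ → ℂ}
    (h : ∀ i ∈ s, HasValInf (F i) (v i)) : HasValInf (∑ i ∈ s, F i) (∑ i ∈ s, v i) := by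
  classical
  induction s using Finset.induction_on with
  | empty => simpa using zero
  | insert i s hi ih =>
    rw [Finset.sum_insert hi, Finset.sum_insert hi]
    exact (h i (by simp)).add (ih fun j hj => h j (by simp [hj]))

theorem unique (h : HasValInf f c) (h' : HasValInf f d) : c = d := by
  obtain ⟨n, a, b, hb, ha, h0, e, v⟩ := h
  obtain ⟨n', a', b', hb', ha', h0', e', v'⟩ := h'
  have key : a * b' = b * a' := by
    apply RatFunc.algebraMap_injective ℂ
    rw [map_mul, map_mul, ← e, ← e']; ring
  have := congrArg (fun p => p.coeff (n + n')) key
  simp only [coeff_mul_add_eq_of_natDegree_le ha hb', coeff_mul_add_eq_of_natDegree_le hb ha',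
    ← v, ← v'] at this
  apply mul_right_cancel₀ (mul_ne_zero h0 h0')
  linear_combination this

theorem inv_X : HasValInf RatFunc.X⁻¹ 0 := by
  refine ⟨1, 1, X, natDegree_X_le, by simp, by simp, ?_, by simp [coeff_one]⟩
  rw [ι_X, inv_mul_cancel₀ X_ne_zero', map_one]

/-- The Euler operator `t d/dt` multiplies the coefficients of `t ^ n` in numerator and denominator
by the same `n`, so the top coefficients in the quotient rule cancel. -/
theorem X_mul_ddt (h : HasValInf f c) : HasValInf (RatFunc.X * ddt f) 0 := by
  obtain ⟨n, a, b, hb, ha, h0, e, -⟩ := h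
  have haux : ∀ q : ℂ[X], q.natDegree ≤ n →
      (X * derivative q).natDegree ≤ n ∧ (X * derivative q).coeff n = n * q.coeff n := by
    intro q hq
    rcases n with _ | n
    · rw [Nat.le_zero, natDegree_eq_zero] at hq
      obtain ⟨x, rfl⟩ := hq
      simp
    · constructor
      · have h1 := natDegree_derivative_le q
        have h2 := natDegree_mul_le (p := X) (q := derivative q)
        rw [natDegree_X] at h2
        omega
      · rw [coeff_X_mul, coeff_derivative]; push_cast; ring
  obtain ⟨a1, a2⟩ := haux a ha
  obtain ⟨b1, b2⟩ := haux b hb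
  refine ⟨n + n, (X * derivative a) * b - a * (X * derivative b), b * b,
    natDegree_mul_le_two_mul hb hb, ?_, ?_, ?_, ?_⟩
  · exact (natDegree_sub_le_of_le (natDegree_mul_le_two_mul a1 hb)
      (natDegree_mul_le_two_mul ha b1)).trans (max_self _).le
  · rw [coeff_mul_add_eq_of_natDegree_le hb hb]; exact mul_ne_zero h0 h0
  · simp only [map_sub, map_mul, ι_X]
    linear_combination RatFunc.X * ddt_mul_sq e
  · rw [coeff_sub, coeff_mul_add_eq_of_natDegree_le a1 hb,
      coeff_mul_add_eq_of_natDegree_le ha b1, a2, b2]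
    ring

theorem ddt (h : HasValInf f c) : HasValInf (A4Painleve.ddt f) 0 := by
  have := inv_X.mul h.X_mul_ddt
  rwa [inv_mul_cancel_left₀ X_ne_zero', zero_mul] at this

theorem X_mul (h : HasValInf f 0) : ∃ c, HasValInf (RatFunc.X * f) c := by
  obtain ⟨n, a, b, hb, ha, h0, e, v⟩ := h
  rw [zero_mul] at v
  refine ⟨(X * a).coeff n / b.coeff n, n, X * a, b, hb, ?_, h0, ?_, div_mul_cancel₀ _ h0⟩
  · rw [natDegree_le_iff_coeff_eq_zero]
    intro N hN
    rcases N with _ | N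
    · omega
    · rw [coeff_X_mul]
      rcases eq_or_lt_of_le (Nat.lt_succ_iff.1 hN) with rfl | h
      · exact v.symm
      · exact coeff_eq_zero_of_natDegree_lt (ha.trans_lt h)
  · rw [map_mul, ι_X]; linear_combination RatFunc.X * e

theorem X_div_unif (p : ℂ) : HasValInf (RatFunc.X * (unif p)⁻¹) 1 := by
  refine ⟨1, X, X - C p, natDegree_X_sub_C_le p, natDegree_X_le, by simp, ?_,
    by simp⟩
  rw [← unif_eq, mul_assoc, inv_mul_cancel₀ (unif_ne_zero p), mul_one, ι_X]

theorem inv_unif (p : ℂ) : HasValInf (unif p)⁻¹ 0 := by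
  have := inv_X.mul (X_div_unif p)
  rwa [inv_mul_cancel_left₀ X_ne_zero', zero_mul] at this

theorem exists_pow (f : RatFunc ℂ) : ∃ m : ℕ, ∃ c, HasValInf (RatFunc.X⁻¹ ^ m * f) c := by
  obtain ⟨a, b, hb, e⟩ := exists_frac f
  obtain ⟨k, hk⟩ : ∃ k, k = a.natDegree := ⟨_, rfl⟩
  have h0 : (X ^ k * b).coeff (b.natDegree + k) ≠ 0 := by
    rw [coeff_X_pow_mul]
    simpa using hb
  have hX := pow_ne_zero k X_ne_zero'
  refine ⟨k, _, b.natDegree + k, a, X ^ k * b, ?_, ?_, h0, ?_, div_mul_cancel₀ _ h0⟩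
  · rw [add_comm]
    exact natDegree_mul_le_two_mul (natDegree_X_pow_le _) le_rfl
  · rw [hk]
    exact Nat.le_add_left _ _
  · rw [map_mul, map_pow, ι_X, ← e, inv_pow]
    field_simp

theorem of_le {f : RatFunc ℂ} {m n : ℕ} (hmn : m ≤ n)
    (h : ∃ c, HasValInf (RatFunc.X⁻¹ ^ m * f) c) : ∃ c, HasValInf (RatFunc.X⁻¹ ^ n * f) c := by
  obtain ⟨c, hc⟩ := h
  obtain ⟨k, rfl⟩ := Nat.exists_eq_add_of_le hmn
  have := (inv_X.pow k).mul hc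
  rw [← mul_assoc, ← pow_add, add_comm] at this
  exact ⟨_, this⟩

theorem ddt_pow_mul {m : ℕ} (h : HasValInf (RatFunc.X⁻¹ ^ m * f) c) :
    HasValInf (RatFunc.X⁻¹ ^ m * (RatFunc.X * A4Painleve.ddt f)) (m * c) := by
  have h1 := h.X_mul_ddt.add ((const m).mul h)
  rw [zero_add] at h1
  convert h1 using 1
  have hX := X_ne_zero'
  have hXm := pow_ne_zero m hX
  have h2 : f = RatFunc.X ^ m * (RatFunc.X⁻¹ ^ m * f) := by
    rw [inv_pow, mul_inv_cancel_left₀ hXm]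
  conv_lhs => rw [h2]
  rw [ddt_mul, A4Painleve.ddt_pow, ddt_X, inv_pow]
  rcases m with _ | m
  · simp
  · simp only [map_natCast, Nat.add_sub_cancel]
    field_simp
    ring

theorem skew {v : Fin 5 → RatFunc ℂ} {c : Fin 5 → ℂ}
    (h : ∀ i, HasValInf (v i) (c i)) (i : Fin 5) :
    HasValInf (skew v i) (skew c i) :=
  (((h _).sub (h _)).add (h _)).sub (h _)

theorem dcubic {v : Fin 5 → RatFunc ℂ} {c : Fin 5 → ℂ}
    (h : ∀ i, HasValInf (v i) (c i)) (i : Fin 5) :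
    HasValInf (dcubic v i) (dcubic c i) :=
  (((h _).mul (h _)).add ((h _).mul (h _))).add ((h _).mul (h _))

theorem cubic {v : Fin 5 → RatFunc ℂ} {c : Fin 5 → ℂ}
    (h : ∀ i, HasValInf (v i) (c i)) : HasValInf (cubic v) (cubic c) :=
  sum fun _ _ => ((h _).mul (h _)).mul (h _)

end HasValInf

/-- The pole order at infinity of a finite family, with the leading coefficients. -/
theorem exists_pole_order_inf {κ : Type*} [Fintype κ] (f : κ → RatFunc ℂ) :
    ∃ m : ℕ, ∃ c : κ → ℂ, (∀ i, HasValInf (RatFunc.X⁻¹ ^ m * f i) (c i)) ∧ (m = 0 ∨ c ≠ 0) := by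
  classical
  have hex : ∃ m : ℕ, ∀ i, ∃ c, HasValInf (RatFunc.X⁻¹ ^ m * f i) c := by
    choose m hm using fun i => HasValInf.exists_pow (f i)
    exact ⟨∑ i, m i, fun i => HasValInf.of_le
      (Finset.single_le_sum (f := m) (fun _ _ => Nat.zero_le _) (Finset.mem_univ i)) (hm i)⟩
  choose c hc using Nat.find_spec hex
  refine ⟨Nat.find hex, c, hc, ?_⟩
  by_contra! hcon
  obtain ⟨h0, hc0⟩ := hcon
  obtain ⟨k, hk⟩ := Nat.exists_eq_succ_of_ne_zero h0
  refine Nat.find_min hex (m := k) (by omega) fun i => ?_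
  have := hc i
  rw [hk, hc0, Nat.succ_eq_add_one, pow_succ', mul_assoc] at this
  obtain ⟨d, hd⟩ := HasValInf.X_mul this
  rw [mul_inv_cancel_left₀ X_ne_zero'] at hd
  exact ⟨d, hd⟩

/-! ### Partial fractions -/

/-- A nonconstant reduced denominator has a complex root, at which the coprime numerator cannot
vanish. -/
theorem eq_poly_of_regular {g : RatFunc ℂ} (h : ∀ p, ∃ c, HasVal p g c) : ∃ a : ℂ[X], g = ι a := by
  have hd : g.denom = 1 := by
    refine eq_one_of_monic_natDegree_zero (RatFunc.monic_denom g) ?_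
    by_contra hdeg
    obtain ⟨p, hp⟩ := IsAlgClosed.exists_root g.denom
      (fun h0 => hdeg (natDegree_eq_of_degree_eq_some h0))
    obtain ⟨c, a, b, hb, e, -⟩ := h p
    have hd0 := ι_ne_zero g.denom_ne_zero
    have key : g.num * b = a * g.denom := by
      apply RatFunc.algebraMap_injective ℂ
      rw [map_mul, map_mul, ← e]
      have : g * ι g.denom = ι g.num := by rw [← eq_div_iff hd0, RatFunc.num_div_denom]
      rw [← this]; ring
    have h1 := congrArg (eval p) key
    rw [eval_mul, eval_mul, hp, mul_zero] at h1
    have hn := (mul_eq_zero.1 h1).resolve_right hb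
    obtain ⟨u, v, huv⟩ := RatFunc.isCoprime_num_denom g
    have h2 := congrArg (eval p) huv
    rw [eval_add, eval_mul, eval_mul, hn, hp] at h2
    simp at h2
  refine ⟨g.num, ?_⟩
  conv_lhs => rw [← RatFunc.num_div_denom g, hd, map_one, div_one]

theorem eq_const_of_regular {g : RatFunc ℂ} {d : ℂ} (h : ∀ p, ∃ c, HasVal p g c)
    (hd : HasValInf g d) : g = RatFunc.C d := by
  obtain ⟨a, rfl⟩ := eq_poly_of_regular h
  obtain ⟨n, a', b, hb, ha', h0, e, -⟩ := id hd
  have key : a * b = a' := by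
    apply RatFunc.algebraMap_injective ℂ
    rw [map_mul, e]
  have ha : a.natDegree = 0 := by
    by_cases ha0 : a = 0
    · simp [ha0]
    have h1 := natDegree_mul ha0 (ne_zero_of_coeff_ne_zero h0)
    have h2 := le_natDegree_of_ne_zero h0
    rw [key] at h1
    omega
  obtain ⟨x, rfl⟩ := natDegree_eq_zero.1 ha
  rw [ι_C] at hd ⊢
  rw [hd.unique (HasValInf.const x)]

/-- Subtracting the principal parts leaves a function regular everywhere including infinity, hence
constant. -/
theorem partial_fraction {f : RatFunc ℂ} {d : ℂ} {P : Finset ℂ} {r : ℂ → ℂ}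
    (h : ∀ p, HasVal p (unif p * f) (r p)) (hr : ∀ p ∉ P, r p = 0) (hd : HasValInf f d) :
    f = RatFunc.C d + ∑ p ∈ P, RatFunc.C (r p) * (unif p)⁻¹ := by
  rw [← sub_eq_iff_eq_add]
  apply eq_const_of_regular
  · intro p
    apply HasVal.div_unif
    have h1 : HasVal p (∑ q ∈ P, unif p * (RatFunc.C (r q) * (unif q)⁻¹))
        (∑ q ∈ P, if q = p then r q else 0) := by
      refine HasVal.sum fun q _ => ?_
      split_ifs with hq
      · rw [hq, mul_left_comm, mul_inv_cancel₀ (unif_ne_zero p), mul_one]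
        exact HasVal.const p _
      · have := (HasVal.unif_self p).mul
          ((HasVal.const p (r q)).mul (HasVal.inv_unif (Ne.symm hq)))
        rwa [zero_mul] at this
    have h2 : (∑ q ∈ P, if q = p then r q else 0) = r p := by
      rw [Finset.sum_ite_eq']
      split_ifs with hp
      · rfl
      · exact (hr p hp).symm
    have h3 := (h p).sub h1
    rwa [h2, sub_self, ← Finset.mul_sum, ← mul_sub] at h3
  · have h1 : HasValInf (∑ p ∈ P, RatFunc.C (r p) * (unif p)⁻¹) (∑ p ∈ P, r p * 0) :=
      HasValInf.sum fun p _ => (HasValInf.const _).mul (HasValInf.inv_unif p)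
    have h2 := hd.sub h1
    simpa using h2

/-- The coefficient of `1/t` at infinity is the sum of the residues. -/
theorem residue_sum {f : RatFunc ℂ} {e : ℂ} {P : Finset ℂ} {r : ℂ → ℂ}
    (h : ∀ p, HasVal p (unif p * f) (r p)) (hr : ∀ p ∉ P, r p = 0)
    (hd : HasValInf f 0) (he : HasValInf (RatFunc.X * f) e) : e = ∑ p ∈ P, r p := by
  rw [partial_fraction h hr hd, map_zero, zero_add, Finset.mul_sum] at he
  have h1 : HasValInf (∑ p ∈ P, RatFunc.X * (RatFunc.C (r p) * (unif p)⁻¹)) (∑ p ∈ P, r p) := by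
    refine HasValInf.sum fun p _ => ?_
    have := (HasValInf.const (r p)).mul (HasValInf.X_div_unif p)
    rwa [mul_one, mul_left_comm] at this
  exact he.unique h1

theorem exists_finset_regular {κ : Type*} [Fintype κ] (f : κ → RatFunc ℂ) :
    ∃ P : Finset ℂ, ∀ p ∉ P, ∀ i, ∃ c, HasVal p (f i) c := by
  classical
  choose a b hb e using fun i => exists_frac (f i)
  refine ⟨Finset.univ.biUnion fun i => (b i).roots.toFinset, fun p hp i => ?_⟩
  have h0 : (b i).eval p ≠ 0 := by
    intro h0
    apply hp
    simp only [Finset.mem_biUnion, Finset.mem_univ, true_and, Multiset.mem_toFinset]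
    exact ⟨i, (mem_roots (hb i)).2 h0⟩
  exact ⟨_, a i, b i, h0, e i, div_mul_cancel₀ _ h0⟩

/-! ### Leading coefficients at infinity -/

/-- The four leading behaviours at infinity, up to rotation. -/
def IsLeading (c : Fin 5 → ℂ) : Prop :=
  c = ![1, 0, 0, 0, 0] ∨ c = ![1, 1, 0, -1, 0] ∨ c = ![1 / 3, 1 / 3, 1 / 3, 0, 0] ∨
    c = ![1 / 5, 1 / 5, 1 / 5, 1 / 5, 1 / 5]

theorem vec_eq_iff {c : Fin 5 → ℂ} {x0 x1 x2 x3 x4 : ℂ} :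
    c = ![x0, x1, x2, x3, x4] ↔ c 0 = x0 ∧ c 1 = x1 ∧ c 2 = x2 ∧ c 3 = x3 ∧ c 4 = x4 := by
  constructor
  · rintro rfl; exact ⟨rfl, rfl, rfl, rfl, rfl⟩
  · rintro ⟨h0, h1, h2, h3, h4⟩
    ext i
    rcases fin_five_cases i with rfl | rfl | rfl | rfl | rfl <;> assumption

theorem exists_isLeading {c : Fin 5 → ℂ} (h : ∀ i, c i * skew c i = 0) (hs : ∑ i, c i = 1) :
    ∃ k, IsLeading fun i => c (i + k) := by
  have h0 := h 0
  have h1 := h 1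
  have h2 := h 2
  have h3 := h 3
  have h4 := h 4
  simp only [skew, mul_eq_zero, Fin.sum_univ_five, Fin.isValue, Fin.reduceAdd] at h0 h1 h2 h3 h4 hs
  clear h
  simp only [IsLeading, vec_eq_iff]
  -- Each choice of vanishing factors gives a linear system that is inconsistent or determines `c`;
  -- the witness is the rotation to the normal form.
  rcases h0 with h0 | h0 <;>
  rcases h1 with h1 | h1 <;>
  rcases h2 with h2 | h2 <;>
  rcases h3 with h3 | h3 <;>
  rcases h4 with h4 | h4
  · exfalso; grind
  · refine ⟨4, Or.inl ?_⟩; simp; grind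
  · refine ⟨3, Or.inl ?_⟩; simp; grind
  · exfalso; grind
  · refine ⟨2, Or.inl ?_⟩; simp; grind
  · exfalso; grind
  · exfalso; grind
  · refine ⟨2, Or.inr (Or.inr (Or.inl ?_))⟩; simp; grind
  · refine ⟨1, Or.inl ?_⟩; simp; grind
  · exfalso; grind
  · exfalso; grind
  · refine ⟨3, Or.inr (Or.inl ?_)⟩; simp; grind
  · exfalso; grind
  · refine ⟨1, Or.inr (Or.inl ?_)⟩; simp; grind
  · refine ⟨1, Or.inr (Or.inr (Or.inl ?_))⟩; simp; grind
  · exfalso; grind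
  · refine ⟨0, Or.inl ?_⟩; simp; grind
  · exfalso; grind
  · exfalso; grind
  · refine ⟨3, Or.inr (Or.inr (Or.inl ?_))⟩; simp; grind
  · exfalso; grind
  · refine ⟨4, Or.inr (Or.inl ?_)⟩; simp; grind
  · refine ⟨2, Or.inr (Or.inl ?_)⟩; simp; grind
  · exfalso; grind
  · exfalso; grind
  · refine ⟨4, Or.inr (Or.inr (Or.inl ?_))⟩; simp; grind
  · refine ⟨0, Or.inr (Or.inl ?_)⟩; simp; grind
  · exfalso; grind
  · refine ⟨0, Or.inr (Or.inr (Or.inl ?_))⟩; simp; grind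
  · exfalso; grind
  · exfalso; grind
  · refine ⟨0, Or.inr (Or.inr (Or.inr ?_))⟩; simp; grind

theorem IsLeading.skew_eq {c : Fin 5 → ℂ} (h : IsLeading c) (i : Fin 5) : c i * skew c i = 0 := by
  rcases h with rfl | rfl | rfl | rfl <;>
    rcases fin_five_cases i with rfl | rfl | rfl | rfl | rfl <;> simp [skew]

/-- The linearization of the quadratic system at a leading vector is injective on vectors of sum
zero. This kills the constant term of the expansion at infinity. -/
theorem IsLeading.nondegenerate {c d : Fin 5 → ℂ} (h : IsLeading c) (hs : ∑ i, d i = 0)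
    (hd : ∀ i, c i * skew d i + d i * skew c i = 0) : d = 0 := by
  have h0 := hd 0
  have h1 := hd 1
  have h2 := hd 2
  have h3 := hd 3
  have h4 := hd 4
  clear hd
  rw [Fin.sum_univ_five] at hs
  have : d 0 = 0 ∧ d 1 = 0 ∧ d 2 = 0 ∧ d 3 = 0 ∧ d 4 = 0 := by
    rcases h with rfl | rfl | rfl | rfl <;> simp [skew] at h0 h1 h2 h3 h4 <;> grind
  obtain ⟨a0, a1, a2, a3, a4⟩ := this
  ext i
  rcases fin_five_cases i with rfl | rfl | rfl | rfl | rfl <;> assumption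

/-- Lagrange condition: a leading vector is a critical point of the cubic form on the hyperplane of
fixed sum. Terms linear in the correction therefore drop out in `cubic_expansion`. -/
theorem IsLeading.dcubic_eq {c : Fin 5 → ℂ} (h : IsLeading c) (j : Fin 5) :
    dcubic c j = dcubic c 0 := by
  rcases h with rfl | rfl | rfl | rfl <;>
    rcases fin_five_cases j with rfl | rfl | rfl | rfl | rfl <;> simp [dcubic]

theorem IsRationalSolution.leading {α : Fin 5 → ℂ} {f : Fin 5 → RatFunc ℂ}
    (h : IsRationalSolution α f) :
    ∃ c : Fin 5 → ℂ, (∀ i, HasValInf (RatFunc.X⁻¹ * f i) (c i)) ∧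
      (∀ i, c i * skew c i = 0) ∧ ∑ i, c i = 1 := by
  obtain ⟨m, c, hc, hm⟩ := exists_pole_order_inf f
  have hX := X_ne_zero'
  have hw := HasValInf.inv_X
  have hsum : ∑ i, (RatFunc.X⁻¹ : RatFunc ℂ) ^ m * f i = RatFunc.X⁻¹ ^ m * RatFunc.X := by
    rw [← Finset.mul_sum, h.2]
  have hs := HasValInf.sum (s := Finset.univ) fun i _ => hc i
  rw [hsum] at hs
  -- Order 0 is impossible because the sum `t` is unbounded; order at least 2 will contradict
  -- `leading_eq_zero`.
  rcases m with _ | m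
  · exfalso
    have h1 := hw.mul hs
    rw [pow_zero, one_mul, inv_mul_cancel₀ hX, zero_mul] at h1
    have := h1.unique (d := 1) (by simpa using HasValInf.const 1)
    exact zero_ne_one this
  have hcs : ∀ i, c i * skew c i = 0 := fun i => by
    have h1 := (hw.pow (m + 2)).mul (hc i).ddt_pow_mul
    have h2 := ((hc i).mul (HasValInf.skew hc i)).add
      ((hw.pow (2 * (m + 1))).mul (HasValInf.const (α i)))
    rw [skew_smul] at h2
    have h3 := h1.unique (d := c i * skew c i + 0 ^ (2 * (m + 1)) * α i) (by
      convert h2 using 1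
      rw [h.ode]
      linear_combination (RatFunc.X⁻¹ ^ (2 * m + 2) * (f i * skew f i + RatFunc.C (α i))) *
        inv_mul_cancel₀ hX)
    simpa using h3.symm
  rw [pow_succ, mul_assoc, inv_mul_cancel₀ hX, mul_one] at hs
  rcases m with _ | m
  · refine ⟨c, by simpa using hc, hcs, ?_⟩
    rw [pow_zero] at hs
    exact hs.unique (by simpa using HasValInf.const 1)
  · exfalso
    have h1 := hs.unique (hw.pow (m + 1))
    rw [zero_pow (Nat.succ_ne_zero m)] at h1
    exact (hm.resolve_left (Nat.succ_ne_zero _)) (leading_eq_zero hcs h1)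

theorem cubic_expansion (c x : RatFunc ℂ) (C g : Fin 5 → RatFunc ℂ)
    (hC : ∀ j, dcubic C j = c) (hg : ∑ i, g i = 0) :
    cubic (fun i => C i * x + g i) =
      cubic C * x ^ 3 + (x * ∑ j, C j * dcubic g j + cubic g) := by
  have h0 := hC 0
  have h1 := hC 1
  have h2 := hC 2
  have h3 := hC 3
  have h4 := hC 4
  simp only [cubic, dcubic, Fin.sum_univ_five, Fin.isValue, Fin.reduceAdd] at *
  linear_combination x ^ 2 * (g 0 * h0 + g 1 * h1 + g 2 * h2 + g 3 * h3 + g 4 * h4 + c * hg)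

/-- The parameters of a solution in terms of its total pole vector, for a given leading behaviour
at infinity. -/
theorem IsRationalSolution.asymptotics {α c : Fin 5 → ℂ} {f : Fin 5 → RatFunc ℂ}
    (h : IsRationalSolution α f) (hc : IsLeading c)
    (hf : ∀ i, HasValInf (RatFunc.X⁻¹ * f i) (c i)) (hc1 : ∑ i, c i = 1) :
    ∃ N : Fin 5 → ℕ, ∃ e : Fin 5 → ℂ, (∀ i, e i = N (i + 4) - N (i + 1)) ∧
      (∀ i, α i = c i - c i * skew e i - e i * skew c i) ∧
      ∑ j, α j * N j = ∑ j, c j * dcubic e j ∧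
      (N = 0 → ∀ i, f i = RatFunc.C (c i) * RatFunc.X) := by
  have hX := X_ne_zero'
  have hw := HasValInf.inv_X
  obtain ⟨g, hg⟩ : ∃ g : Fin 5 → RatFunc ℂ, ∀ i, f i = RatFunc.C (c i) * RatFunc.X + g i :=
    ⟨fun i => f i - RatFunc.C (c i) * RatFunc.X, fun i => by ring⟩
  have hgs : ∑ i, g i = 0 := by
    have h1 := h.2
    simp only [hg, Finset.sum_add_distrib, ← Finset.sum_mul, ← map_sum, hc1] at h1
    simpa using h1
  have hwg : ∀ i, HasValInf (RatFunc.X⁻¹ * g i) 0 := fun i => by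
    have h1 := (hf i).sub (HasValInf.const (c i))
    rw [sub_self] at h1
    convert h1 using 1
    rw [hg]
    field_simp
    ring
  have hode : ∀ i, ddt (g i) + RatFunc.C (c i) = RatFunc.X *
      (RatFunc.C (c i) * skew g i + g i * RatFunc.C (skew c i)) + g i * skew g i +
      RatFunc.C (α i) := fun i => by
    have h1 := h.ode i
    have h2 := congrArg (RatFunc.C : ℂ →+* RatFunc ℂ) (hc.skew_eq i)
    simp only [skew, hg, ddt_add, ddt_C_mul, ddt_X, map_mul, map_add, map_sub, map_zero] at h1 h2 ⊢
    linear_combination h1 + RatFunc.X ^ 2 * h2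
  have hd : ∃ d : Fin 5 → ℂ, ∀ i, HasValInf (g i) (d i) := by
    choose d hd using fun i => (hwg i).X_mul
    exact ⟨d, fun i => by simpa [mul_inv_cancel_left₀ hX] using hd i⟩
  obtain ⟨d, hd⟩ := hd
  -- The terms of order `t` in the equations for `g` say that `d` lies in the kernel of the
  -- linearization at `c`.
  have hd0 : d = 0 := by
    refine hc.nondegenerate ?_ fun i => ?_
    · have := HasValInf.sum (s := Finset.univ) fun i _ => hd i
      rw [hgs] at this
      exact this.unique HasValInf.zero
    · have h1 := (((HasValInf.const (c i)).mul (HasValInf.skew hd i)).add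
        ((hd i).mul (HasValInf.const (skew c i))))
      have h2 := hw.mul ((((hd i).ddt).add (HasValInf.const (c i))).sub
        (((hd i).mul (HasValInf.skew hd i)).add (HasValInf.const (α i))))
      rw [hode, zero_mul] at h2
      refine h1.unique ?_
      convert h2 using 1
      field_simp
      ring
  subst hd0
  choose e he using fun i => (hd i).X_mul
  -- These are the terms of order `t ^ 0`; the derivative of `g` and its quadratic term tend to 0.
  have hα : ∀ i, α i = c i - c i * skew e i - e i * skew c i := fun i => by
    have h1 := (((HasValInf.const (c i)).mul (HasValInf.skew he i)).add
        ((he i).mul (HasValInf.const (skew c i)))).add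
        ((((hd i).mul (HasValInf.skew hd i)).add (HasValInf.const (α i))))
    have h2 := ((hd i).ddt).add (HasValInf.const (c i))
    have h3 := h2.unique (d := c i * skew e i + e i * skew c i +
        ((0 : Fin 5 → ℂ) i * skew (0 : Fin 5 → ℂ) i + α i)) (by
      convert h1 using 1
      rw [hode, skew_smul]
      ring)
    simp only [Pi.zero_apply] at h3
    linear_combination -h3
  -- As `g` is of order `1/t`, the quadratic part of the correction to the cubic contributes to
  -- `1/t`, while `cubic g` is of order `1/t ^ 3`.
  have hq : HasValInf (RatFunc.X * (RatFunc.X * ∑ j, RatFunc.C (c j) * dcubic g j + cubic g))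
      (∑ j, c j * dcubic e j) := by
    have h1 : HasValInf (∑ j, RatFunc.C (c j) * dcubic (fun i => RatFunc.X * g i) j)
        (∑ j, c j * dcubic e j) :=
      HasValInf.sum fun j _ => (HasValInf.const _).mul (HasValInf.dcubic he j)
    have h2 := h1.add ((hw.pow 2).mul (HasValInf.cubic he))
    rw [zero_pow two_ne_zero, zero_mul, add_zero] at h2
    convert h2 using 1
    simp only [dcubic_smul, cubic, Fin.sum_univ_five]
    field_simp
  obtain ⟨w, hw'⟩ : ∃ w : RatFunc ℂ, w = RatFunc.X * ∑ j, RatFunc.C (c j) * dcubic g j + cubic g :=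
    ⟨_, rfl⟩
  rw [← hw'] at hq
  have hcub : cubic f = RatFunc.C (cubic c) * RatFunc.X ^ 3 + w := by
    have h1 := cubic_expansion (RatFunc.C (dcubic c 0)) RatFunc.X (fun i => RatFunc.C (c i)) g
      (fun j => by rw [← hc.dcubic_eq j]; simp [dcubic]) hgs
    rw [← hw', show (fun i => RatFunc.C (c i) * RatFunc.X + g i) = f from
      funext fun i => (hg i).symm] at h1
    rw [h1]
    simp [cubic]
  have hw0 : HasValInf w 0 := by
    have := hw.mul hq
    rwa [inv_mul_cancel_left₀ hX, zero_mul] at this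
  choose n hn hnG hn0 using fun p => h.residue p
  obtain ⟨P, hP⟩ := exists_finset_regular f
  have hP0 : ∀ p ∉ P, n p = 0 := fun p hp => by
    refine hn0 p fun i => ?_
    obtain ⟨v, hv⟩ := hP p hp i
    have h1 := (HasVal.unif_self p).mul hv
    rw [zero_mul] at h1
    have h2 := (hn p i).unique h1
    exact_mod_cast sub_eq_zero.1 h2
  have hgr : ∀ i p, HasVal p (unif p * g i) (n p (i + 4) - n p (i + 1)) := fun i p => by
    have h1 := (hn p i).sub ((HasVal.unif_self p).mul ((HasVal.const p (c i)).mul (HasVal.var p)))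
    rw [zero_mul, sub_zero] at h1
    convert h1 using 1
    rw [hg]; ring
  have hwr : ∀ p, HasVal p (unif p * w) (∑ j, α j * n p j) := fun p => by
    have h1 := (hnG p).sub ((HasVal.unif_self p).mul
      ((HasVal.const p (cubic c)).mul ((HasVal.var p).pow 3)))
    rw [zero_mul, sub_zero] at h1
    convert h1 using 1
    rw [hcub]; ring
  refine ⟨∑ p ∈ P, n p, e, fun i => ?_, hα, ?_, fun hN i => ?_⟩
  · rw [residue_sum (P := P) (hgr i) (fun p hp => by simp [hP0 p hp]) (hd i) (he i)]
    simp [Finset.sum_apply]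
  · rw [residue_sum (P := P) hwr (fun p hp => by simp [hP0 p hp]) hw0 hq, Finset.sum_comm]
    simp [Finset.sum_apply, Finset.mul_sum]
  · have hz : ∀ p ∈ P, n p = 0 := by
      simpa [Finset.sum_eq_zero_iff] using hN
    rw [hg, partial_fraction (P := P) (hgr i) (fun p hp => by simp [hP0 p hp]) (hd i),
      Finset.sum_eq_zero fun p hp => by simp [hz p hp]]
    simp

/-! ### Solutions with parameters in the fundamental alcove -/

section arithmetic

variable {n0 n1 n2 n3 n4 : ℤ}

/-- The `z` are the parameters: nonnegative integers of sum 1, so finitely many. Differences of the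
`n` are affine in `z`, hence the quadratic side becomes a number once `z` is fixed, and what remains
is linear in the `n`. The same device settles `poles_mixed` and, with parameters scaled by 3,
`poles_three`. -/
theorem poles_one (p1 : 0 ≤ n1) (p4 : 0 ≤ n4)
    (h0 : 0 ≤ 1 - 2 * n0 + n4 + n1) (h1 : 0 ≤ n0 - n2) (h2 : 0 ≤ n3 - n1) (h3 : 0 ≤ n2 - n4)
    (h4 : 0 ≤ n0 - n3)
    (R : (1 - 2 * n0 + n4 + n1) * n0 + (n0 - n2) * n1 + (n3 - n1) * n2 + (n2 - n4) * n3 +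
      (n0 - n3) * n4 = (n0 - n2) * (n1 - n3) + (n3 - n0) * (n0 - n2) + (n2 - n4) * (n3 - n0)) :
    n0 = 0 ∧ n1 = 0 ∧ n2 = 0 ∧ n3 = 0 ∧ n4 = 0 := by
  obtain ⟨z0, e0⟩ : ∃ z, z = 1 - 2 * n0 + n4 + n1 := ⟨_, rfl⟩
  obtain ⟨z1, e1⟩ : ∃ z, z = n0 - n2 := ⟨_, rfl⟩
  obtain ⟨z2, e2⟩ : ∃ z, z = n3 - n1 := ⟨_, rfl⟩
  obtain ⟨z3, e3⟩ : ∃ z, z = n2 - n4 := ⟨_, rfl⟩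
  obtain ⟨z4, e4⟩ : ∃ z, z = n0 - n3 := ⟨_, rfl⟩
  have R' : z0 * n0 + z1 * n1 + z2 * n2 + z3 * n3 + z4 * n4 = -(z1 * z2 + z4 * z1 + z3 * z4) := by
    subst e0 e1 e2 e3 e4
    linear_combination R
  rw [← e0] at h0
  rw [← e1] at h1
  rw [← e2] at h2
  rw [← e3] at h3
  rw [← e4] at h4
  clear R
  have hs : z0 + z1 + z2 + z3 + z4 = 1 := by omega
  have c0 : z0 ≤ 1 := by omega
  have c1 : z1 ≤ 1 := by omega
  have c2 : z2 ≤ 1 := by omega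
  have c3 : z3 ≤ 1 := by omega
  interval_cases z0 <;> interval_cases z1 <;> (try omega) <;> interval_cases z2 <;> (try omega) <;>
    interval_cases z3 <;> (try omega) <;>
    (obtain rfl | rfl : z4 = 0 ∨ z4 = 1 := by omega) <;> omega

theorem poles_mixed (p2 : 0 ≤ n2) (p4 : 0 ≤ n4)
    (h0 : 0 ≤ 1 - 2 * n0 + n4 + n1) (h1 : 0 ≤ 1 - 2 * n1 + n0 + n2) (h2 : 0 ≤ n1 - n3)
    (h3 : 0 ≤ -1 + 2 * n3 - n2 - n4) (h4 : 0 ≤ n0 - n3)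
    (R : (1 - 2 * n0 + n4 + n1) * n0 + (1 - 2 * n1 + n0 + n2) * n1 + (n1 - n3) * n2 +
      (-1 + 2 * n3 - n2 - n4) * n3 + (n0 - n3) * n4 =
      ((n0 - n2) * (n1 - n3) + (n3 - n0) * (n0 - n2) + (n2 - n4) * (n3 - n0)) +
      ((n1 - n3) * (n2 - n4) + (n4 - n1) * (n1 - n3) + (n3 - n0) * (n4 - n1)) -
      ((n3 - n0) * (n4 - n1) + (n1 - n3) * (n3 - n0) + (n0 - n2) * (n1 - n3))) : False := by
  obtain ⟨z0, e0⟩ : ∃ z, z = 1 - 2 * n0 + n4 + n1 := ⟨_, rfl⟩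
  obtain ⟨z1, e1⟩ : ∃ z, z = 1 - 2 * n1 + n0 + n2 := ⟨_, rfl⟩
  obtain ⟨z2, e2⟩ : ∃ z, z = n1 - n3 := ⟨_, rfl⟩
  obtain ⟨z3, e3⟩ : ∃ z, z = -1 + 2 * n3 - n2 - n4 := ⟨_, rfl⟩
  obtain ⟨z4, e4⟩ : ∃ z, z = n0 - n3 := ⟨_, rfl⟩
  have R' : z0 * n0 + z1 * n1 + z2 * n2 + z3 * n3 + z4 * n4 =
      ((1 - z1 - 2 * z2 + 2 * z4) * z2 - z4 * (1 - z1 - 2 * z2 + 2 * z4) -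
        (z1 - z0 + 3 * z2 - 3 * z4) * z4) +
      (z2 * (z1 - z0 + 3 * z2 - 3 * z4) + (z0 - 1 - 2 * z2 + 2 * z4) * z2 -
        z4 * (z0 - 1 - 2 * z2 + 2 * z4)) -
      (- z4 * (z0 - 1 - 2 * z2 + 2 * z4) - z2 * z4 + (1 - z1 - 2 * z2 + 2 * z4) * z2) := by
    subst e0 e1 e2 e3 e4
    linear_combination R
  rw [← e0] at h0
  rw [← e1] at h1
  rw [← e2] at h2
  rw [← e3] at h3
  rw [← e4] at h4
  clear R
  have hs : z0 + z1 + z2 + z3 + z4 = 1 := by omega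
  have c0 : z0 ≤ 1 := by omega
  have c1 : z1 ≤ 1 := by omega
  have c2 : z2 ≤ 1 := by omega
  have c3 : z3 ≤ 1 := by omega
  interval_cases z0 <;> interval_cases z1 <;> (try omega) <;> interval_cases z2 <;> (try omega) <;>
    interval_cases z3 <;> (try omega) <;>
    (obtain rfl | rfl : z4 = 0 ∨ z4 = 1 := by omega) <;> omega

theorem poles_three (p3 : 0 ≤ n3) (p4 : 0 ≤ n4)
    (h0 : 0 ≤ 1 - 2 * n0 + n4 + n1) (h1 : 0 ≤ 1 - 2 * n1 + n0 + n2)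
    (h2 : 0 ≤ 1 - 2 * n2 + n1 + n3) (h3 : 0 ≤ n2 - n4) (h4 : 0 ≤ n0 - n3)
    (R : (1 - 2 * n0 + n4 + n1) * n0 + (1 - 2 * n1 + n0 + n2) * n1 +
      (1 - 2 * n2 + n1 + n3) * n2 + (n2 - n4) * n3 + (n0 - n3) * n4 =
      ((n0 - n2) * (n1 - n3) + (n3 - n0) * (n0 - n2) + (n2 - n4) * (n3 - n0)) +
      ((n1 - n3) * (n2 - n4) + (n4 - n1) * (n1 - n3) + (n3 - n0) * (n4 - n1)) +
      ((n2 - n4) * (n3 - n0) + (n0 - n2) * (n2 - n4) + (n4 - n1) * (n0 - n2))) :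
    n0 = 0 ∧ n1 = 0 ∧ n2 = 0 ∧ n3 = 0 ∧ n4 = 0 := by
  obtain ⟨z0, e0⟩ : ∃ z, z = 1 - 2 * n0 + n4 + n1 := ⟨_, rfl⟩
  obtain ⟨z1, e1⟩ : ∃ z, z = 1 - 2 * n1 + n0 + n2 := ⟨_, rfl⟩
  obtain ⟨z2, e2⟩ : ∃ z, z = 1 - 2 * n2 + n1 + n3 := ⟨_, rfl⟩
  obtain ⟨z3, e3⟩ : ∃ z, z = n2 - n4 := ⟨_, rfl⟩
  obtain ⟨z4, e4⟩ : ∃ z, z = n0 - n3 := ⟨_, rfl⟩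
  -- The factor 54 clears the denominators that arise when differences of the `n` are written in
  -- terms of `z`.
  have R' : 54 * (z0 * n0 + z1 * n1 + z2 * n2 + z3 * n3 + z4 * n4) =
      18 * (z3 * z3 + z4 * z4 + z4 * (z0 - z1) + z3 * (z2 - z1)) -
      ((z1 + z2 - 2 * z0 - 2 * z3 - 2 * z4) * (z1 + z2 - 2 * z0 - 2 * z3 - 2 * z4) +
        (z0 + z2 - 2 * z1 + 4 * z3 + 4 * z4) * (z0 + z2 - 2 * z1 + 4 * z3 + 4 * z4) +
        (z0 + z1 - 2 * z2 - 2 * z3 - 2 * z4) * (z0 + z1 - 2 * z2 - 2 * z3 - 2 * z4)) := by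
    subst e0 e1 e2 e3 e4
    linear_combination 54 * R
  rw [← e0] at h0
  rw [← e1] at h1
  rw [← e2] at h2
  rw [← e3] at h3
  rw [← e4] at h4
  clear R
  have hs : z0 + z1 + z2 + z3 + z4 = 3 := by omega
  have c0 : z0 ≤ 3 := by omega
  have c1 : z1 ≤ 3 := by omega
  have c2 : z2 ≤ 3 := by omega
  have c3 : z3 ≤ 3 := by omega
  interval_cases z0 <;> interval_cases z1 <;> (try omega) <;> interval_cases z2 <;> (try omega) <;>
    interval_cases z3 <;> (try omega) <;>
    (obtain rfl | rfl | rfl | rfl : z4 = 0 ∨ z4 = 1 ∨ z4 = 2 ∨ z4 = 3 := by omega) <;> omega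

/-- The right side of `R` equals minus half the sum of the squares of the cyclic differences of the
`n`, while the left side is nonnegative. So all `n` agree, and `R` becomes `5 * n0 = 0`. -/
theorem poles_five (p0 : 0 ≤ n0) (p1 : 0 ≤ n1) (p2 : 0 ≤ n2) (p3 : 0 ≤ n3) (p4 : 0 ≤ n4)
    (h0 : 0 ≤ 1 - 2 * n0 + n4 + n1) (h1 : 0 ≤ 1 - 2 * n1 + n0 + n2)
    (h2 : 0 ≤ 1 - 2 * n2 + n1 + n3) (h3 : 0 ≤ 1 - 2 * n3 + n2 + n4)
    (h4 : 0 ≤ 1 - 2 * n4 + n3 + n0)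
    (R : (1 - 2 * n0 + n4 + n1) * n0 + (1 - 2 * n1 + n0 + n2) * n1 +
      (1 - 2 * n2 + n1 + n3) * n2 + (1 - 2 * n3 + n2 + n4) * n3 + (1 - 2 * n4 + n3 + n0) * n4 =
      ((n0 - n2) * (n1 - n3) + (n3 - n0) * (n0 - n2) + (n2 - n4) * (n3 - n0)) +
      ((n1 - n3) * (n2 - n4) + (n4 - n1) * (n1 - n3) + (n3 - n0) * (n4 - n1)) +
      ((n2 - n4) * (n3 - n0) + (n0 - n2) * (n2 - n4) + (n4 - n1) * (n0 - n2)) +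
      ((n3 - n0) * (n4 - n1) + (n1 - n3) * (n3 - n0) + (n0 - n2) * (n1 - n3)) +
      ((n4 - n1) * (n0 - n2) + (n2 - n4) * (n4 - n1) + (n1 - n3) * (n2 - n4))) :
    n0 = 0 ∧ n1 = 0 ∧ n2 = 0 ∧ n3 = 0 ∧ n4 = 0 := by
  have L : 0 ≤ (1 - 2 * n0 + n4 + n1) * n0 + (1 - 2 * n1 + n0 + n2) * n1 +
      (1 - 2 * n2 + n1 + n3) * n2 + (1 - 2 * n3 + n2 + n4) * n3 +
      (1 - 2 * n4 + n3 + n0) * n4 := by positivity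
  have S : (n0 - n1) ^ 2 + (n1 - n2) ^ 2 + (n2 - n3) ^ 2 + (n3 - n4) ^ 2 + (n4 - n0) ^ 2 ≤ 0 := by
    rw [R] at L
    linarith
  have hz : ∀ x : ℤ, x ^ 2 ≤ 0 → x = 0 := fun x hx =>
    pow_eq_zero_iff two_ne_zero |>.1 (le_antisymm hx (sq_nonneg x))
  have q0 := sq_nonneg (n0 - n1)
  have q1 := sq_nonneg (n1 - n2)
  have q2 := sq_nonneg (n2 - n3)
  have q3 := sq_nonneg (n3 - n4)
  have q4 := sq_nonneg (n4 - n0)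
  have d0 := hz _ (show (n0 - n1) ^ 2 ≤ 0 by linarith)
  have d1 := hz _ (show (n1 - n2) ^ 2 ≤ 0 by linarith)
  have d2 := hz _ (show (n2 - n3) ^ 2 ≤ 0 by linarith)
  have d3 := hz _ (show (n3 - n4) ^ 2 ≤ 0 by linarith)
  obtain rfl : n0 = n1 := by omega
  obtain rfl : n0 = n2 := by omega
  obtain rfl : n0 = n3 := by omega
  obtain rfl : n0 = n4 := by omega
  have : n0 = 0 := by linarith
  simp [this]

end arithmetic

theorem int_nonneg_of_div {z : ℤ} {k : ℕ} (hk : 0 < k) {r : ℝ} (hr : 0 ≤ r)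
    (h : (z : ℂ) / k = r) : 0 ≤ z := by
  have h1 : ((z : ℝ) / k : ℝ) = r := by exact_mod_cast h
  have hk' : (0 : ℝ) < k := by exact_mod_cast hk
  rw [div_eq_iff hk'.ne'] at h1
  have : (0 : ℝ) ≤ z := by rw [h1]; positivity
  exact_mod_cast this

/-- The parameters lie in the closed fundamental alcove. -/
def Nonneg (α : Fin 5 → ℂ) : Prop := ∀ i, ∃ r : ℝ, 0 ≤ r ∧ α i = r

/-- The four leading vectors lead to the four arithmetic lemmas, after scaling by the denominators
1, 1, 3, 5. The vector with a negative entry is incompatible with nonnegative parameters. -/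
theorem no_poles {α c e : Fin 5 → ℂ} {N : Fin 5 → ℕ} (hα : Nonneg α) (hc : IsLeading c)
    (he : ∀ i, e i = N (i + 4) - N (i + 1))
    (hp : ∀ i, α i = c i - c i * skew e i - e i * skew c i)
    (hq : ∑ j, α j * N j = ∑ j, c j * dcubic e j) : N = 0 ∧ c ≠ ![1, 1, 0, -1, 0] := by
  obtain ⟨n, hn⟩ : ∃ n : Fin 5 → ℤ, ∀ i, (N i : ℤ) = n i := ⟨fun i => N i, fun _ => rfl⟩
  have hpos : ∀ i, 0 ≤ n i := fun i => hn i ▸ Int.natCast_nonneg _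
  have hnC : ∀ i, (N i : ℂ) = n i := fun i => by rw [← hn]; simp
  have hN : (n 0 = 0 ∧ n 1 = 0 ∧ n 2 = 0 ∧ n 3 = 0 ∧ n 4 = 0) → N = 0 := by
    rintro ⟨a0, a1, a2, a3, a4⟩
    ext i
    have := hn i
    rw [Pi.zero_apply, ← Int.natCast_inj, this]
    rcases fin_five_cases i with rfl | rfl | rfl | rfl | rfl <;> assumption
  have sign : ∀ (i : Fin 5) (z : ℤ) (k : ℕ), 0 < k → α i = (z : ℂ) / k → 0 ≤ z := by
    intro i z k hk h
    obtain ⟨r, hr, hr'⟩ := hα i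
    exact int_nonneg_of_div hk hr (h ▸ hr')
  simp only [hnC] at he hq
  have e0 := he 0
  have e1 := he 1
  have e2 := he 2
  have e3 := he 3
  have e4 := he 4
  have s0 := sign 0
  have s1 := sign 1
  have s2 := sign 2
  have s3 := sign 3
  have s4 := sign 4
  have p0 := hp 0
  have p1 := hp 1
  have p2 := hp 2
  have p3 := hp 3
  have p4 := hp 4
  rw [p0] at s0
  rw [p1] at s1
  rw [p2] at s2
  rw [p3] at s3
  rw [p4] at s4
  simp only [Fin.sum_univ_five, p0, p1, p2, p3, p4] at hq
  have g0 := hpos 0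
  have g1 := hpos 1
  have g2 := hpos 2
  have g3 := hpos 3
  have g4 := hpos 4
  simp only [skew, dcubic, Fin.isValue, Fin.reduceAdd, e0, e1, e2, e3, e4] at hq s0 s1 s2 s3 s4
  clear hα he hp hpos hnC sign hn e0 e1 e2 e3 e4 p0 p1 p2 p3 p4
  generalize n 0 = n0, n 1 = n1, n 2 = n2, n 3 = n3, n 4 = n4 at *
  rcases hc with rfl | rfl | rfl | rfl
  · refine ⟨hN (poles_one (n0 := n0) (n1 := n1) (n2 := n2) (n3 := n3) (n4 := n4)
      g1 g4 (s0 _ 1 one_pos ?_) (s1 _ 1 one_pos ?_)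
      (s2 _ 1 one_pos ?_) (s3 _ 1 one_pos ?_) (s4 _ 1 one_pos ?_) ?_), ?_⟩
    iterate 5 (simp <;> ring1)
    · apply Int.cast_injective (α := ℂ)
      simp at hq
      push_cast
      linear_combination 1 * hq
    · intro h
      have := congrFun h 1
      norm_num at this
  · refine (poles_mixed (n0 := n0) (n1 := n1) (n2 := n2) (n3 := n3) (n4 := n4)
      g2 g4 (s0 _ 1 one_pos ?_) (s1 _ 1 one_pos ?_)
      (s2 _ 1 one_pos ?_) (s3 _ 1 one_pos ?_) (s4 _ 1 one_pos ?_) ?_).elim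
    iterate 5 (simp <;> ring1)
    · apply Int.cast_injective (α := ℂ)
      simp at hq
      push_cast
      linear_combination 1 * hq
  · refine ⟨hN (poles_three (n0 := n0) (n1 := n1) (n2 := n2) (n3 := n3) (n4 := n4)
      g3 g4 (s0 _ 3 three_pos ?_) (s1 _ 3 three_pos ?_)
      (s2 _ 3 three_pos ?_) (s3 _ 3 three_pos ?_) (s4 _ 3 three_pos ?_) ?_), ?_⟩
    iterate 5 (simp; ring1)
    · apply Int.cast_injective (α := ℂ)
      simp at hq
      push_cast
      linear_combination 3 * hq
    · intro h
      have := congrFun h 1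
      norm_num at this
  · refine ⟨hN (poles_five (n0 := n0) (n1 := n1) (n2 := n2) (n3 := n3) (n4 := n4)
      g0 g1 g2 g3 g4 (s0 _ 5 (by norm_num) ?_) (s1 _ 5 (by norm_num) ?_)
      (s2 _ 5 (by norm_num) ?_) (s3 _ 5 (by norm_num) ?_) (s4 _ 5 (by norm_num) ?_) ?_), ?_⟩
    iterate 5 (simp; ring1)
    · apply Int.cast_injective (α := ℂ)
      simp at hq
      push_cast
      linear_combination 5 * hq
    · intro h
      have := congrFun h 1
      norm_num at this

/-! ### Reduction to the fundamental alcove -/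

theorem sum_shift {R : Type*} [AddCommMonoid R] (a : Fin 5 → R) (k : Fin 5) :
    ∑ i, a (i + k) = ∑ i, a i :=
  Equiv.sum_comp (Equiv.addRight k) a

theorem refl_refl {R : Type*} [AddCommGroup R] (i : Fin 5) (a : Fin 5 → R) :
    refl i (refl i a) = a := by
  have h1 : i + 1 ≠ i := by revert i; decide
  have h2 : i - 1 ≠ i := by revert i; decide
  ext j
  by_cases hj : j = i
  · subst hj; simp [refl]
  · by_cases hk : j = i + 1 ∨ j = i - 1
    · simp [refl, hj, hk]
    · simp [refl, hj, hk]

theorem sum_refl {R : Type*} [CommRing R] (i : Fin 5) (a : Fin 5 → R) :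
    ∑ j, refl i a j = ∑ j, a j := by
  have hm : (-1 : Fin 5) = 4 := rfl
  rcases fin_five_cases i with rfl | rfl | rfl | rfl | rfl <;>
    simp [Fin.sum_univ_five, refl, hm] <;> ring

theorem refl_shift {R : Type*} [AddCommGroup R] (i k : Fin 5) (a : Fin 5 → R) :
    refl i (fun j => a (j + k)) = fun j => refl (i + k) a (j + k) := by
  ext j
  have h1 : (j + k = i + k + 1) ↔ j = i + 1 := by rw [add_right_comm, add_left_inj]
  have h2 : (j + k = i + k - 1) ↔ j = i - 1 := by
    rw [add_sub_right_comm, add_left_inj]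
  simp only [refl, add_left_inj, h1, h2]

theorem refl_div (M : ℕ) (i : Fin 5) (a : Fin 5 → ℤ) :
    refl i (fun j => (a j : ℂ) / M) = fun j => ((refl i a j : ℤ) : ℂ) / M := by
  ext j
  simp only [refl]
  split_ifs <;> push_cast <;> ring

/-- A quadratic form measuring the distance to the barycenter of the fundamental alcove. -/
def alcoveForm (a : Fin 5 → ℤ) : ℤ := ∑ i, (a i ^ 2 + (a i + a (i + 1)) ^ 2)

theorem alcoveForm_nonneg (a : Fin 5 → ℤ) : 0 ≤ alcoveForm a :=
  Finset.sum_nonneg fun _ _ => by positivity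

theorem alcoveForm_refl (i : Fin 5) (a : Fin 5 → ℤ) :
    alcoveForm (refl i a) = alcoveForm a + 2 * a i * ∑ j, a j := by
  have hm : (-1 : Fin 5) = 4 := rfl
  rcases fin_five_cases i with rfl | rfl | rfl | rfl | rfl <;>
    simp [alcoveForm, Fin.sum_univ_five, refl, hm] <;> ring

/-- Descent on `alcoveForm`: since the sum `M` is positive, reflecting in a negative coordinate
strictly lowers it (`alcoveForm_refl`). -/
theorem alcove_induction {M : ℕ} (hM : 0 < M) {P : (Fin 5 → ℤ) → Prop}
    (base : ∀ a, (∀ i, 0 ≤ a i) → ∑ i, a i = (M : ℤ) → P a)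
    (step : ∀ a i, ∑ i, a i = (M : ℤ) → P (refl i a) → P a) (a : Fin 5 → ℤ)
    (ha : ∑ i, a i = (M : ℤ)) :
    P a := by
  induction hn : (alcoveForm a).toNat using Nat.strong_induction_on generalizing a with
  | _ n ih =>
    by_cases h : ∀ i, 0 ≤ a i
    · exact base a h ha
    · push Not at h
      obtain ⟨i, hi⟩ := h
      refine step a i ha (ih _ ?_ _ (by rw [sum_refl, ha]) rfl)
      have h1 := alcoveForm_refl i a
      have h2 := alcoveForm_nonneg (refl i a)
      rw [ha] at h1
      have h3 : 2 * a i * (M : ℤ) < 0 := by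
        have : (0 : ℤ) < M := by exact_mod_cast hM
        nlinarith
      omega

theorem nonneg_div {M : ℕ} {a : Fin 5 → ℤ} (ha : ∀ i, 0 ≤ a i) :
    Nonneg fun i => (a i : ℂ) / M := fun i =>
  ⟨(a i : ℝ) / M, div_nonneg (by exact_mod_cast ha i) (Nat.cast_nonneg M), by push_cast; rfl⟩

/-! ### Rational solutions in terms of their parameters -/

/-- The parameters of the three seed solutions. -/
def IsSeed (c : Fin 5 → ℂ) : Prop :=
  c = seedOne.α ∨ c = seedTwo.α ∨ c = seedThree.α

theorem IsSeed.isLeading {c : Fin 5 → ℂ} (h : IsSeed c) : IsLeading c := by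
  rcases h with h | h | h
  · exact Or.inl h
  · exact Or.inr (Or.inr (Or.inl h))
  · exact Or.inr (Or.inr (Or.inr h))

theorem IsSeed.sum_eq {c : Fin 5 → ℂ} (h : IsSeed c) : ∑ i, c i = 1 := by
  rcases h with rfl | rfl | rfl <;>
    simp [Fin.sum_univ_five, seedOne, seedTwo, seedThree] <;> norm_num

theorem IsRationalSolution.exists_shift {α : Fin 5 → ℂ} {f : Fin 5 → RatFunc ℂ}
    (h : IsRationalSolution α f) :
    ∃ k, ∃ c : Fin 5 → ℂ, IsLeading c ∧ ∃ N : Fin 5 → ℕ, ∃ e : Fin 5 → ℂ,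
      (∀ i, e i = N (i + 4) - N (i + 1)) ∧
      (∀ i, α (i + k) = c i - c i * skew e i - e i * skew c i) ∧
      ∑ j, α (j + k) * N j = ∑ j, c j * dcubic e j ∧
      (N = 0 → ∀ i, f (i + k) = RatFunc.C (c i) * RatFunc.X) := by
  obtain ⟨c, hc, hs, h1⟩ := h.leading
  obtain ⟨k, hk⟩ := exists_isLeading hs h1
  exact ⟨k, _, hk, (h.shift k).asymptotics hk (fun i => hc _) (by rw [sum_shift, h1])⟩

theorem IsRationalSolution.of_nonneg {α : Fin 5 → ℂ} {f : Fin 5 → RatFunc ℂ}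
    (h : IsRationalSolution α f) (hα : Nonneg α) :
    (∃ k, IsSeed fun i => α (i + k)) ∧ ∀ i, f i = RatFunc.C (α i) * RatFunc.X := by
  obtain ⟨k, c, hc, N, e, he, hp, hq, hf⟩ := h.exists_shift
  obtain ⟨hN, hb⟩ := no_poles (fun i => hα (i + k)) hc he hp hq
  have he0 : e = 0 := funext fun i => by simp [he, hN]
  have hαc : ∀ i, α (i + k) = c i := fun i => by rw [hp, he0]; simp [skew]
  refine ⟨⟨k, ?_⟩, fun i => ?_⟩
  · rw [show (fun i => α (i + k)) = c from funext hαc]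
    rcases hc with h | h | h | h
    · exact Or.inl h
    · exact absurd h hb
    · exact Or.inr (Or.inl h)
    · exact Or.inr (Or.inr h)
  · have := hf hN (i - k)
    rwa [← hαc, sub_add_cancel] at this

theorem isRationalSolution_linear {c : Fin 5 → ℂ} (h : ∀ i, c i * skew c i = 0)
    (hs : ∑ i, c i = 1) : IsRationalSolution c fun i => RatFunc.C (c i) * RatFunc.X := by
  constructor
  · intro i
    have h2 := congrArg (RatFunc.C : ℂ →+* RatFunc ℂ) (h i)
    simp only [skew, map_mul, map_add, map_sub, map_zero] at h2
    rw [ddt_C_mul, ddt_X]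
    linear_combination -RatFunc.X ^ 2 * h2
  · rw [← Finset.sum_mul, ← map_sum, hs, map_one, one_mul]

theorem IsLeading.int_div {c : Fin 5 → ℂ} (h : IsLeading c) :
    ∃ w : Fin 5 → ℤ, ∀ i, c i = w i / 15 := by
  rcases h with rfl | rfl | rfl | rfl
  · refine ⟨![15, 0, 0, 0, 0], fun i => ?_⟩
    rcases fin_five_cases i with rfl | rfl | rfl | rfl | rfl <;> simp
  · refine ⟨![15, 15, 0, -15, 0], fun i => ?_⟩
    rcases fin_five_cases i with rfl | rfl | rfl | rfl | rfl <;> simp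
  · refine ⟨![5, 5, 5, 0, 0], fun i => ?_⟩
    rcases fin_five_cases i with rfl | rfl | rfl | rfl | rfl <;> simp <;> norm_num
  · refine ⟨![3, 3, 3, 3, 3], fun i => ?_⟩
    rcases fin_five_cases i with rfl | rfl | rfl | rfl | rfl <;> simp <;> norm_num

/-- The parameters are linear in `c` with integral coefficients, because `e` is integral; 15 is a
common denominator of all leading vectors. This makes `alcove_induction` available for every
solution. -/
theorem IsRationalSolution.int_div {α : Fin 5 → ℂ} {f : Fin 5 → RatFunc ℂ}
    (h : IsRationalSolution α f) :
    ∃ a : Fin 5 → ℤ, α = (fun i => (a i : ℂ) / (15 : ℕ)) ∧ ∑ i, a i = (15 : ℕ) := by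
  obtain ⟨k, c, hc, N, e, he, hp, -, -⟩ := h.exists_shift
  obtain ⟨w, hw⟩ := hc.int_div
  obtain ⟨E, hE⟩ : ∃ E : Fin 5 → ℤ, ∀ i, e i = E i :=
    ⟨fun i => N (i + 4) - N (i + 1), fun i => by rw [he]; push_cast; rfl⟩
  have hα : α = fun i => ((w (i - k) - w (i - k) * skew E (i - k) -
      E (i - k) * skew w (i - k) : ℤ) : ℂ) / (15 : ℕ) := by
    ext i
    have := hp (i - k)
    rw [sub_add_cancel] at this
    rw [this]
    simp only [skew, hw, hE]
    push_cast
    ring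
  refine ⟨_, hα, ?_⟩
  have hs := h.sum_param
  rw [hα, ← Finset.sum_div, div_eq_one_iff_eq (by norm_num)] at hs
  exact_mod_cast hs

theorem sFun_eq_mk {α : Fin 5 → ℂ} {f : Fin 5 → RatFunc ℂ}
    (h : IsRationalSolution α f) (i : Fin 5) :
    sFun i ⟨α, f⟩ = ⟨refl i α, (sFun i ⟨α, f⟩).f⟩ := by
  ext1
  · exact (h.sFun i).1
  · rfl

theorem IsRationalSolution.unique {α : Fin 5 → ℂ} {f g : Fin 5 → RatFunc ℂ}
    (hf : IsRationalSolution α f) (hg : IsRationalSolution α g) : f = g := by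
  obtain ⟨a, rfl, ha⟩ := hf.int_div
  refine alcove_induction (by norm_num) (P := fun a => ∀ f g,
    IsRationalSolution (fun i => (a i : ℂ) / (15 : ℕ)) f →
    IsRationalSolution (fun i => (a i : ℂ) / (15 : ℕ)) g → f = g) ?_ ?_ a ha f g hf hg
  · intro a ha _ f g hf hg
    ext1 i
    rw [(hf.of_nonneg (nonneg_div ha)).2, (hg.of_nonneg (nonneg_div ha)).2]
  · intro a i _ ih f g hf hg
    rw [← refl_div] at ih
    have h1 := ih _ _ (hf.sFun i).2 (hg.sFun i).2
    have h2 := sFun_eq_mk hf i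
    rw [h1, ← sFun_eq_mk hg i] at h2
    exact congrArg State.f ((sFun_involutive i).injective h2)

/-! ### Bäcklund orbits of solutions and their invariants. -/

theorem s_mem (i : Fin 5) : s i ∈ backlundGroup := Subgroup.subset_closure (Or.inl ⟨i, rfl⟩)

theorem rot_mem : rot ∈ backlundGroup := Subgroup.subset_closure (Or.inr rfl)

theorem exists_shift_mem (k : Fin 5) :
    ∃ σ ∈ backlundGroup, ∀ x, σ x = ⟨fun i => x.α (i + k), fun i => x.f (i + k)⟩ := by
  refine ⟨rot ^ (k : ℕ), Subgroup.pow_mem _ rot_mem _, fun x => ?_⟩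
  rcases fin_five_cases k with rfl | rfl | rfl | rfl | rfl <;>
    simp [pow_succ, rot, add_assoc]

theorem seed_eq {x : State} (hx : ∀ i, x.f i = RatFunc.C (x.α i) * RatFunc.X) (h : IsSeed x.α) :
    x = seedOne ∨ x = seedTwo ∨ x = seedThree := by
  have hC : ∀ m : ℕ, RatFunc.C (1 / (m : ℂ)) * RatFunc.X = RatFunc.X / (m : RatFunc ℂ) := fun m => by
    rw [map_div₀, map_one, map_natCast]; ring
  have h3 := hC 3
  have h5 := hC 5
  norm_cast at h3 h5
  refine h.imp (fun h => ?_) (Or.imp (fun h => ?_) fun h => ?_) <;>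
  · refine State.ext h (funext fun i => ?_)
    rw [hx, h]
    rcases fin_five_cases i with rfl | rfl | rfl | rfl | rfl <;>
      simp_all [seedOne, seedTwo, seedThree]

theorem IsRationalSolution.exists_backlund {α : Fin 5 → ℂ} {f : Fin 5 → RatFunc ℂ}
    (hf : IsRationalSolution α f) : ∃ σ ∈ backlundGroup,
      σ ⟨α, f⟩ = seedOne ∨ σ ⟨α, f⟩ = seedTwo ∨ σ ⟨α, f⟩ = seedThree := by
  obtain ⟨a, rfl, ha⟩ := hf.int_div
  refine alcove_induction (by norm_num) (P := fun a => ∀ f,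
    IsRationalSolution (fun i => (a i : ℂ) / (15 : ℕ)) f → ∃ σ ∈ backlundGroup,
      σ ⟨fun i => (a i : ℂ) / (15 : ℕ), f⟩ = seedOne ∨
      σ ⟨fun i => (a i : ℂ) / (15 : ℕ), f⟩ = seedTwo ∨
      σ ⟨fun i => (a i : ℂ) / (15 : ℕ), f⟩ = seedThree) ?_ ?_ a ha f hf
  · intro a ha _ f hf
    obtain ⟨⟨k, hk⟩, hlin⟩ := hf.of_nonneg (nonneg_div ha)
    obtain ⟨σ, hσ, h⟩ := exists_shift_mem k
    refine ⟨σ, hσ, ?_⟩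
    rw [h]
    exact seed_eq (fun i => hlin (i + k)) hk
  · intro a i _ ih f hf
    rw [← refl_div] at ih
    obtain ⟨σ, hσ, h⟩ := ih _ (hf.sFun i).2
    refine ⟨σ * s i, Subgroup.mul_mem _ hσ (s_mem i), ?_⟩
    rwa [Equiv.Perm.mul_apply, s_apply, sFun_eq_mk hf i]

theorem backlund_invariant {Q : (Fin 5 → ℂ) → Prop} (hr : ∀ i α, Q α → Q (refl i α))
    (hs : ∀ k α, Q α → Q fun i => α (i + k)) {σ : Equiv.Perm State} (hσ : σ ∈ backlundGroup)
    (x : State) : Q (σ x).α ↔ Q x.α := by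
  have hS : ∀ i x, Q x.α → Q (s i x).α := fun i x h => by
    by_cases hx : x.f i = 0
    · simpa [s_apply, sFun, hx] using h
    · rw [s_apply, (sFun_of_ne_zero hx).1]
      exact hr i _ h
  induction hσ using Subgroup.closure_induction generalizing x with
  | mem τ hτ =>
    rcases hτ with ⟨i, rfl⟩ | rfl
    · refine ⟨fun h => ?_, hS i x⟩
      have := hS i _ h
      rwa [s_apply, s_apply, sFun_involutive i x] at this
    · refine ⟨fun h => ?_, hs 1 _⟩
      -- The shift by 4 undoes the rotation.
      have := hs 4 _ h
      simpa [rot, add_assoc] using this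
  | one => rfl
  | mul σ τ _ _ h1 h2 => exact (h1 (τ x)).trans (h2 x)
  | inv σ _ h =>
    have := h (σ⁻¹ x)
    rw [show σ (σ⁻¹ x) = x from σ.apply_symm_apply x] at this
    exact this.symm

/-! ### Congruence conditions on the parameters -/

/-- Some cyclic shift of `α` is congruent modulo `ℤ` to `w / M` for an integer vector `w` from the
list `W`. -/
def ModCongr (M : ℕ) (W : List (Fin 5 → ℤ)) (α : Fin 5 → ℂ) : Prop :=
  ∃ i : Fin 5, ∃ w ∈ W, ShiftCongr α i fun k => (w k : ℂ) / M

/-- The zero vector. -/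
def residuesOne : List (Fin 5 → ℤ) := [![0, 0, 0, 0, 0]]

/-- The residue vectors modulo `3` of `3 α` in the second case. -/
def residuesTwo : List (Fin 5 → ℤ) :=
  [![1, 1, 1, 0, 0], ![-1, -1, -1, 0, 0], ![1, -1, -1, 1, 0], ![-1, 1, 1, -1, 0]]

/-- The residue vectors modulo `5` of `5 α` in the third case. -/
def residuesThree : List (Fin 5 → ℤ) :=
  [![1, 1, 1, 1, 1], ![2, 2, 2, 2, 2], ![3, 3, 3, 3, 3], ![4, 4, 4, 4, 4],
    ![1, 2, 1, 3, 3], ![2, 4, 2, 6, 6], ![3, 6, 3, 9, 9], ![4, 8, 4, 12, 12]]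

theorem condOne_iff {α : Fin 5 → ℂ} : CondOne α ↔ ModCongr 1 residuesOne α := by
  have h0 : (fun k => ((![0, 0, 0, 0, 0] : Fin 5 → ℤ) k : ℂ) / (1 : ℕ)) = 0 := by
    ext k
    rcases fin_five_cases k with rfl | rfl | rfl | rfl | rfl <;> simp
  constructor
  · intro h
    refine ⟨0, _, List.mem_singleton_self _, ?_⟩
    rw [h0]
    intro k
    simpa using h k
  · rintro ⟨i, w, hw, h⟩ j
    rw [residuesOne, List.mem_singleton] at hw
    subst hw
    rw [h0] at h
    simpa using h (j - i)

theorem condTwo_iff {α : Fin 5 → ℂ} : CondTwo α ↔ ModCongr 3 residuesTwo α := by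
  have h1 : (1 / 3 : ℂ) • ![1, 1, 1, 0, 0] =
      fun k => ((![1, 1, 1, 0, 0] : Fin 5 → ℤ) k : ℂ) / (3 : ℕ) := by
    ext k
    rcases fin_five_cases k with rfl | rfl | rfl | rfl | rfl <;> simp
  have h2 : -(1 / 3 : ℂ) • ![1, 1, 1, 0, 0] =
      fun k => ((![-1, -1, -1, 0, 0] : Fin 5 → ℤ) k : ℂ) / (3 : ℕ) := by
    ext k
    rcases fin_five_cases k with rfl | rfl | rfl | rfl | rfl <;> simp <;> ring
  have h3 : (1 / 3 : ℂ) • ![1, -1, -1, 1, 0] =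
      fun k => ((![1, -1, -1, 1, 0] : Fin 5 → ℤ) k : ℂ) / (3 : ℕ) := by
    ext k
    rcases fin_five_cases k with rfl | rfl | rfl | rfl | rfl <;> simp <;> ring
  have h4 : -(1 / 3 : ℂ) • ![1, -1, -1, 1, 0] =
      fun k => ((![-1, 1, 1, -1, 0] : Fin 5 → ℤ) k : ℂ) / (3 : ℕ) := by
    ext k
    rcases fin_five_cases k with rfl | rfl | rfl | rfl | rfl <;> simp <;> ring
  simp only [CondTwo, ModCongr, residuesTwo, List.mem_cons, List.not_mem_nil, or_false,
    exists_eq_or_imp, exists_eq_left, h1, h2, h3, h4]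

theorem condThree_iff {α : Fin 5 → ℂ} : CondThree α ↔ ModCongr 5 residuesThree α := by
  have h1 : ∀ j : ℕ, (j / 5 : ℂ) • ![1, 1, 1, 1, 1] =
      fun k => ((![(j : ℤ), j, j, j, j] : Fin 5 → ℤ) k : ℂ) / (5 : ℕ) := by
    intro j
    ext k
    rcases fin_five_cases k with rfl | rfl | rfl | rfl | rfl <;> simp
  have h2 : ∀ j : ℕ, (j / 5 : ℂ) • ![1, 2, 1, 3, 3] =
      fun k => ((![(j : ℤ), j * 2, j, j * 3, j * 3] : Fin 5 → ℤ) k : ℂ) / (5 : ℕ) := by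
    intro j
    ext k
    rcases fin_five_cases k with rfl | rfl | rfl | rfl | rfl <;> simp <;> ring
  have key : ∀ i, (∃ j : ℕ, 1 ≤ j ∧ j ≤ 4 ∧
      (ShiftCongr α i ((j / 5 : ℂ) • ![1, 1, 1, 1, 1]) ∨
        ShiftCongr α i ((j / 5 : ℂ) • ![1, 2, 1, 3, 3]))) ↔
      ∃ w ∈ residuesThree, ShiftCongr α i fun k => (w k : ℂ) / (5 : ℕ) := by
    intro i
    simp only [h1, h2]
    constructor
    · rintro ⟨j, hj1, hj4, h | h⟩ <;> refine ⟨_, ?_, h⟩ <;> interval_cases j <;>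
        simp [residuesThree]
    · rintro ⟨w, hw, h⟩
      simp only [residuesThree, List.mem_cons, List.not_mem_nil, or_false] at hw
      rcases hw with rfl | rfl | rfl | rfl | rfl | rfl | rfl | rfl
      · exact ⟨1, by norm_num, by norm_num, Or.inl h⟩
      · exact ⟨2, by norm_num, by norm_num, Or.inl h⟩
      · exact ⟨3, by norm_num, by norm_num, Or.inl h⟩
      · exact ⟨4, by norm_num, by norm_num, Or.inl h⟩
      · exact ⟨1, by norm_num, by norm_num, Or.inr h⟩
      · exact ⟨2, by norm_num, by norm_num, Or.inr h⟩
      · exact ⟨3, by norm_num, by norm_num, Or.inr h⟩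
      · exact ⟨4, by norm_num, by norm_num, Or.inr h⟩
  exact exists_congr key

theorem modCongr_div_iff {M : ℕ} (hM : 0 < M) {W : List (Fin 5 → ℤ)} {a : Fin 5 → ℤ} :
    ModCongr M W (fun j => (a j : ℂ) / M) ↔
      ∃ i : Fin 5, ∃ w ∈ W, ∀ k, (M : ℤ) ∣ a (i + k) - w k := by
  have hM' : (M : ℂ) ≠ 0 := Nat.cast_ne_zero.2 hM.ne'
  refine exists_congr fun i => exists_congr fun w => and_congr_right fun _ =>
    forall_congr' fun k => exists_congr fun n => ?_
  rw [div_add' _ _ _ hM', div_left_inj' hM', sub_eq_iff_eq_add', mul_comm (n : ℂ)]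
  exact_mod_cast Iff.rfl

theorem ModCongr.exists_div {M : ℕ} (hM : 0 < M) {W : List (Fin 5 → ℤ)} {α : Fin 5 → ℂ}
    (h : ModCongr M W α) : ∃ a : Fin 5 → ℤ, α = fun j => (a j : ℂ) / M := by
  have hM' : (M : ℂ) ≠ 0 := Nat.cast_ne_zero.2 hM.ne'
  obtain ⟨i, w, -, h⟩ := h
  choose n hn using h
  refine ⟨fun j => w (j - i) + M * n (j - i), funext fun j => ?_⟩
  have := hn (j - i)
  rw [add_sub_cancel] at this
  rw [this]
  push_cast
  field_simp

/-- The list of residue vectors is closed, up to rotations, under the reflections. -/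
def ReflClosed (M : ℕ) (W : List (Fin 5 → ℤ)) : Prop :=
  ∀ w ∈ W, ∀ k : Fin 5, ∃ i : Fin 5, ∃ w' ∈ W, ∀ j, (M : ℤ) ∣ refl k w (i + j) - w' j

theorem reflClosed_one : ReflClosed 1 residuesOne := by
  unfold ReflClosed residuesOne refl; decide +kernel

theorem reflClosed_two : ReflClosed 3 residuesTwo := by
  unfold ReflClosed residuesTwo refl; decide +kernel

theorem reflClosed_three : ReflClosed 5 residuesThree := by
  unfold ReflClosed residuesThree refl; decide +kernel

theorem refl_add {R : Type*} [AddCommGroup R] (k : Fin 5) (a b : Fin 5 → R) :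
    refl k (a + b) = refl k a + refl k b := by
  ext j
  simp only [refl, Pi.add_apply]
  split_ifs <;> abel

theorem refl_mul (k : Fin 5) (M : ℤ) (a : Fin 5 → ℤ) (j : Fin 5) :
    refl k (fun i => M * a i) j = M * refl k a j := by
  simp only [refl]
  split_ifs <;> ring

/-- Reflections are linear, so they act separately on the residue vector and on the multiple of `M`;
conjugating by the rotation turns index `k` into `k - i`. -/
theorem ModCongr.refl {M : ℕ} (hM : 0 < M) {W : List (Fin 5 → ℤ)} (hW : ReflClosed M W)
    (k : Fin 5) {α : Fin 5 → ℂ} (h : ModCongr M W α) : ModCongr M W (refl k α) := by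
  obtain ⟨a, rfl⟩ := h.exists_div hM
  rw [refl_div, modCongr_div_iff hM]
  rw [modCongr_div_iff hM] at h
  obtain ⟨i, w, hw, h⟩ := h
  choose n hn using h
  obtain ⟨i', w', hw', h'⟩ := hW w hw (k - i)
  refine ⟨i + i', w', hw', fun j => ?_⟩
  have ha : (fun j => a (j + i)) = w + fun j => (M : ℤ) * n j := by
    ext j
    simp only [Pi.add_apply, ← hn, add_comm j i]
    ring
  have h1 := congrFun (refl_shift (k - i) i a) (i' + j)
  rw [ha, refl_add, sub_add_cancel, Pi.add_apply, refl_mul] at h1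
  have h2 : i' + j + i = i + i' + j := by abel
  rw [h2] at h1
  rw [← h1, add_sub_right_comm]
  exact dvd_add (h' j) (dvd_mul_right _ _)

theorem ModCongr.shift {M : ℕ} {W : List (Fin 5 → ℤ)}
    (k : Fin 5) {α : Fin 5 → ℂ} (h : ModCongr M W α) : ModCongr M W fun i => α (i + k) := by
  obtain ⟨i, w, hw, h⟩ := h
  refine ⟨i - k, w, hw, fun j => ?_⟩
  have : i - k + j + k = i + j := by abel
  simpa only [this] using h j

theorem ModCongr.backlund {M : ℕ} (hM : 0 < M) {W : List (Fin 5 → ℤ)} (hW : ReflClosed M W)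
    {σ : Equiv.Perm State} (hσ : σ ∈ backlundGroup) (x : State) :
    ModCongr M W (σ x).α ↔ ModCongr M W x.α :=
  backlund_invariant (fun k _ h => h.refl hM hW k) (fun k _ h => h.shift k) hσ x

/-- Reflect the parameters into the alcove, where `hseed` supplies a linear solution up to rotation,
and return with the same `s i`, since `refl i` is an involution. -/
theorem exists_solution {M : ℕ} (hM : 0 < M) {W : List (Fin 5 → ℤ)} (hW : ReflClosed M W)
    (hseed : ∀ a : Fin 5 → ℤ, (∀ i, 0 ≤ a i) → ∑ i, a i = (M : ℤ) → ∀ w ∈ W,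
      (∀ k, (M : ℤ) ∣ a k - w k) → IsSeed fun i => (a i : ℂ) / M)
    {α : Fin 5 → ℂ} (hs : ∑ i, α i = 1) (h : ModCongr M W α) :
    ∃ f, IsRationalSolution α f := by
  obtain ⟨a, rfl⟩ := h.exists_div hM
  have ha : ∑ i, a i = (M : ℤ) := by
    rw [← Finset.sum_div, div_eq_one_iff_eq (Nat.cast_ne_zero.2 hM.ne')] at hs
    exact_mod_cast hs
  refine alcove_induction hM (P := fun a => ModCongr M W (fun i => (a i : ℂ) / M) →
    ∃ f, IsRationalSolution (fun i => (a i : ℂ) / M) f) ?_ ?_ a ha h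
  · intro a ha hs h
    rw [modCongr_div_iff hM] at h
    obtain ⟨i, w, hw, h⟩ := h
    have hseed := hseed (fun j => a (j + i)) (fun _ => ha _) (by rw [sum_shift, hs]) w hw
      (fun k => by rw [add_comm]; exact h k)
    have h1 := (isRationalSolution_linear hseed.isLeading.skew_eq hseed.sum_eq).shift (-i)
    simp only [neg_add_cancel_right] at h1
    exact ⟨_, h1⟩
  · intro a i hs ih h
    rw [← refl_div] at ih
    obtain ⟨f, hf⟩ := ih (h.refl hM hW i)
    have := (hf.sFun i).2
    rw [refl_refl] at this
    exact ⟨_, this⟩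

theorem vec_div_eq {a : Fin 5 → ℤ} {M : ℕ} {x0 x1 x2 x3 x4 : ℤ}
    (h : a 0 = x0 ∧ a 1 = x1 ∧ a 2 = x2 ∧ a 3 = x3 ∧ a 4 = x4) :
    (fun i => (a i : ℂ) / M) =
      ![(x0 : ℂ) / M, (x1 : ℂ) / M, (x2 : ℂ) / M, (x3 : ℂ) / M, (x4 : ℂ) / M] := by
  obtain ⟨rfl, rfl, rfl, rfl, rfl⟩ := h
  ext i
  rcases fin_five_cases i with rfl | rfl | rfl | rfl | rfl <;> rfl

theorem exists_solution_two {α : Fin 5 → ℂ} (hs : ∑ i, α i = 1)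
    (h : ModCongr 3 residuesTwo α) : ∃ f, IsRationalSolution α f := by
  refine exists_solution three_pos reflClosed_two (fun a ha hs w hw hd => ?_) hs h
  have d0 := hd 0
  have d1 := hd 1
  have d2 := hd 2
  have d3 := hd 3
  have d4 := hd 4
  have a0 := ha 0
  have a1 := ha 1
  have a2 := ha 2
  have a3 := ha 3
  have a4 := ha 4
  rw [Fin.sum_univ_five] at hs
  -- The least nonnegative residues modulo 3 sum to 3 for the first vector of the list and to 6 for
  -- the others, whereas `a` sums to 3.
  have : a 0 = 1 ∧ a 1 = 1 ∧ a 2 = 1 ∧ a 3 = 0 ∧ a 4 = 0 := by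
    simp only [residuesTwo, List.mem_cons, List.not_mem_nil, or_false] at hw
    rcases hw with rfl | rfl | rfl | rfl <;> simp at d0 d1 d2 d3 d4 hs <;> omega
  refine Or.inr (Or.inl ?_)
  rw [vec_div_eq this]
  simp [seedTwo]

theorem exists_solution_three {α : Fin 5 → ℂ} (hs : ∑ i, α i = 1)
    (h : ModCongr 5 residuesThree α) : ∃ f, IsRationalSolution α f := by
  refine exists_solution (by norm_num) reflClosed_three (fun a ha hs w hw hd => ?_) hs h
  have d0 := hd 0
  have d1 := hd 1
  have d2 := hd 2
  have d3 := hd 3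
  have d4 := hd 4
  have a0 := ha 0
  have a1 := ha 1
  have a2 := ha 2
  have a3 := ha 3
  have a4 := ha 4
  rw [Fin.sum_univ_five] at hs
  -- Modulo 5 the residues of every other vector sum to 10 or more, whereas `a` sums to 5.
  have : a 0 = 1 ∧ a 1 = 1 ∧ a 2 = 1 ∧ a 3 = 1 ∧ a 4 = 1 := by
    simp only [residuesThree, List.mem_cons, List.not_mem_nil, or_false] at hw
    rcases hw with rfl | rfl | rfl | rfl | rfl | rfl | rfl | rfl <;>
      simp at d0 d1 d2 d3 d4 hs <;> omega
  refine Or.inr (Or.inr ?_)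
  rw [vec_div_eq this]
  simp [seedThree]

/-- Handled apart from `exists_solution`: modulo 1 the residues do not locate the entry 1, so the
alcove point is a seed only after a further rotation. -/
theorem exists_solution_one {α : Fin 5 → ℂ} (hs : ∑ i, α i = 1)
    (h : CondOne α) : ∃ f, IsRationalSolution α f := by
  choose a ha using h
  have hα : α = fun i => (a i : ℂ) / (1 : ℕ) := funext fun i => by simp [ha]
  have hsa : ∑ i, a i = (1 : ℕ) := by
    simp only [ha] at hs
    exact_mod_cast hs
  rw [hα]
  refine alcove_induction one_pos (P := fun a =>
    ∃ f, IsRationalSolution (fun i => (a i : ℂ) / (1 : ℕ)) f) ?_ ?_ a hsa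
  · intro a ha hs
    obtain ⟨k, hk⟩ : ∃ k, a k = 1 := by
      by_contra! hne
      have h0 : ∀ i, a i = 0 := fun i => by
        have h1 := Finset.single_le_sum (f := a) (fun i _ => ha i) (Finset.mem_univ i)
        have h2 := hne i
        have h3 := ha i
        omega
      simp [h0] at hs
    have h1 : ∀ i, i ≠ k → a i = 0 := fun i hi => by
      have h2 := Finset.add_le_sum (f := a) (fun i _ => ha i) (Finset.mem_univ i)
        (Finset.mem_univ k) hi
      have h3 := ha i
      omega
    have hseed : IsSeed fun i => (a (i + k) : ℂ) / (1 : ℕ) := by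
      refine Or.inl ?_
      rw [vec_div_eq (a := fun i => a (i + k)) (x0 := 1) (x1 := 0) (x2 := 0) (x3 := 0) (x4 := 0)]
      · simp [seedOne]
      · refine ⟨by simpa using hk, ?_, ?_, ?_, ?_⟩ <;> exact h1 _ (by simp)
    have h1 := (isRationalSolution_linear hseed.isLeading.skew_eq hseed.sum_eq).shift (-k)
    simp only [neg_add_cancel_right] at h1
    exact ⟨_, h1⟩
  · rintro a i hs ⟨f, hf⟩
    rw [← refl_div] at hf
    have := (hf.sFun i).2
    rw [refl_refl] at this
    exact ⟨_, this⟩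

/-! ### The three cases are mutually exclusive on the seeds -/

theorem eq_of_div_eq {m n : ℤ} {M N : ℕ} (hM : 0 < M) (hN : 0 < N) (h : (m : ℂ) / M = n / N) :
    m * N = n * M := by
  have hM' : (M : ℂ) ≠ 0 := Nat.cast_ne_zero.2 hM.ne'
  have hN' : (N : ℂ) ≠ 0 := Nat.cast_ne_zero.2 hN.ne'
  rw [div_eq_div_iff hM' hN'] at h
  exact_mod_cast h

theorem modCongr_seedOne {M : ℕ} (hM : 0 < M) {W : List (Fin 5 → ℤ)}
    (hW : ∀ w ∈ W, ¬ (M : ℤ) ∣ w 0) : ¬ ModCongr M W seedOne.α := by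
  have h1 : seedOne.α = fun i => ((M * (![1, 0, 0, 0, 0] : Fin 5 → ℤ) i : ℤ) : ℂ) / M := by
    have hM' : (M : ℂ) ≠ 0 := Nat.cast_ne_zero.2 hM.ne'
    ext i
    rcases fin_five_cases i with rfl | rfl | rfl | rfl | rfl <;> simp [seedOne, hM']
  rw [h1, modCongr_div_iff hM]
  rintro ⟨i, w, hw, h⟩
  exact hW w hw ((dvd_sub_right (dvd_mul_right _ _)).1 (h 0))

/-- Parameters satisfying the congruence have denominators dividing `M`, which `1 / N` does not. -/
theorem modCongr_of_inv {M N : ℕ} (hM : 0 < M) (hN : 0 < N) (hMN : ¬ (N : ℤ) ∣ M)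
    {W : List (Fin 5 → ℤ)} {α : Fin 5 → ℂ} (h0 : α 0 = 1 / N) : ¬ ModCongr M W α := by
  intro h
  obtain ⟨a, rfl⟩ := h.exists_div hM
  have := eq_of_div_eq (n := 1) hM hN (by simpa using h0)
  exact hMN ⟨a 0, by linarith⟩

theorem not_dvd_residuesTwo : ∀ w ∈ residuesTwo, ¬ ((3 : ℕ) : ℤ) ∣ w 0 := by
  unfold residuesTwo; decide

theorem not_dvd_residuesThree : ∀ w ∈ residuesThree, ¬ ((5 : ℕ) : ℤ) ∣ w 0 := by
  unfold residuesThree; decide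

theorem seedOne_modCongr : ModCongr 1 residuesOne seedOne.α := by
  rw [← condOne_iff]
  intro i
  rcases fin_five_cases i with rfl | rfl | rfl | rfl | rfl
  · exact ⟨1, by simp [seedOne]⟩
  all_goals exact ⟨0, by simp [seedOne]⟩

theorem seedTwo_modCongr : ModCongr 3 residuesTwo seedTwo.α := by
  refine ⟨0, ![1, 1, 1, 0, 0], by simp [residuesTwo], fun k => ⟨0, ?_⟩⟩
  rcases fin_five_cases k with rfl | rfl | rfl | rfl | rfl <;> simp [seedTwo]

theorem seedThree_modCongr : ModCongr 5 residuesThree seedThree.α := by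
  refine ⟨0, ![1, 1, 1, 1, 1], by simp [residuesThree], fun k => ⟨0, ?_⟩⟩
  rcases fin_five_cases k with rfl | rfl | rfl | rfl | rfl <;> simp [seedThree]

end A4Painleve

end

theorem theorem1 (α : Fin 5 → ℂ) :
    ((∃ f : Fin 5 → RatFunc ℂ, A4Painleve.IsRationalSolution α f) ↔
      (∑ i : Fin 5, α i = 1 ∧
        (A4Painleve.CondOne α ∨ A4Painleve.CondTwo α ∨ A4Painleve.CondThree α))) ∧
    (∀ f g : Fin 5 → RatFunc ℂ,
      A4Painleve.IsRationalSolution α f → A4Painleve.IsRationalSolution α g → f = g) ∧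
    (∀ f : Fin 5 → RatFunc ℂ, A4Painleve.IsRationalSolution α f →
      (A4Painleve.CondOne α →
        ∃ σ ∈ A4Painleve.backlundGroup, σ ⟨α, f⟩ = A4Painleve.seedOne) ∧
      (A4Painleve.CondTwo α →
        ∃ σ ∈ A4Painleve.backlundGroup, σ ⟨α, f⟩ = A4Painleve.seedTwo) ∧
      (A4Painleve.CondThree α →
        ∃ σ ∈ A4Painleve.backlundGroup, σ ⟨α, f⟩ = A4Painleve.seedThree)) := by
  open A4Painleve in
  have inv1 := fun {σ} hσ f => ModCongr.backlund one_pos reflClosed_one (σ := σ) hσ (⟨α, f⟩ : State)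
  have inv2 := fun {σ} hσ f => ModCongr.backlund three_pos reflClosed_two (σ := σ) hσ (⟨α, f⟩ : State)
  have inv3 := fun {σ} hσ f =>
    ModCongr.backlund (by norm_num) reflClosed_three (σ := σ) hσ (⟨α, f⟩ : State)
  simp only [condOne_iff, condTwo_iff, condThree_iff]
  refine ⟨⟨?_, ?_⟩, fun f g hf hg => hf.unique hg, fun f hf => ?_⟩
  · rintro ⟨f, hf⟩
    refine ⟨hf.sum_param, ?_⟩
    obtain ⟨σ, hσ, h | h | h⟩ := hf.exists_backlund
    · exact Or.inl ((inv1 hσ f).1 (h ▸ seedOne_modCongr))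
    · exact Or.inr (Or.inl ((inv2 hσ f).1 (h ▸ seedTwo_modCongr)))
    · exact Or.inr (Or.inr ((inv3 hσ f).1 (h ▸ seedThree_modCongr)))
  · rintro ⟨hs, h | h | h⟩
    · exact exists_solution_one hs (condOne_iff.2 h)
    · exact exists_solution_two hs h
    · exact exists_solution_three hs h
  -- Some seed is reached; the condition is invariant along the orbit and fails for the two other
  -- seeds.
  · obtain ⟨σ, hσ, h⟩ := hf.exists_backlund
    refine ⟨fun hc => ⟨σ, hσ, ?_⟩, fun hc => ⟨σ, hσ, ?_⟩, fun hc => ⟨σ, hσ, ?_⟩⟩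
    · have hc := (inv1 hσ f).2 hc
      rcases h with h | h | h
      · exact h
      · exact absurd (h ▸ hc)
          (modCongr_of_inv (N := 3) one_pos three_pos (by decide) (by simp [seedTwo]))
      · exact absurd (h ▸ hc)
          (modCongr_of_inv (N := 5) one_pos (by norm_num) (by decide) (by simp [seedThree]))
    · have hc := (inv2 hσ f).2 hc
      rcases h with h | h | h
      · exact absurd (h ▸ hc) (modCongr_seedOne three_pos not_dvd_residuesTwo)
      · exact h
      · exact absurd (h ▸ hc)
          (modCongr_of_inv (N := 5) three_pos (by norm_num) (by decide) (by simp [seedThree]))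
    · have hc := (inv3 hσ f).2 hc
      rcases h with h | h | h
      · exact absurd (h ▸ hc) (modCongr_seedOne (by norm_num) not_dvd_residuesThree)
      · exact absurd (h ▸ hc)
          (modCongr_of_inv (N := 3) (by norm_num) three_pos (by decide) (by simp [seedTwo]))
      · exact h
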